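/- Let $a,b>0$ and let $n\ge 0$, $1\le m\le n+1$ be integers. **Model.** The dual graph of the Aztec diamond of order $n$ has as vertices the integer points $(X,Y)$ with $0\le X,Y\le 2n$ and $X+Y$ odd; two vertices are joined when both of their coordinates differ by exactly $1$. Its weighted faces are the $n^2$ faces centred at $(2i+1,2j+1)$, $0\le i,j<n$, and every edge borders exactly one of them; the face $(i,j)$ has weight $a$ if $i+j$ is even and $b$ if $i+j$ is odd (so the bottom-left face has weight $a$). A configuration $c$ is a perfect matching (dimer covering) of the graph. Its weight is $w(c)=\prod_{(i,j)} w_{i,j}^{N_{i,j}(c)}$, where $w_{i,j}\in\{a,b\}$ is the weight of the face $(i,j)$ and $N_{i,j}(c)$ is the number of dimers on its boundary. Put $Z_n=\sum_c w(c)$ and $\mathbb P(c)=w(c)/Z_n$. For $1\le \ell\le n$ there is a particle on level $\ell$ at height $k\in\{0,\dots,n\}$ if the vertex $(2\ell-1,2k)$ is matched with a vertex of the column $X=2\ell$; the additional level $n+1$ is completely filled (particles at $0,1,\dots,n$). Write $x^{(\ell)}=(x^{(\ell)}_1,\dots,x^{(\ell)}_\ell)$, and let $\rho(x^{(m)},\dots,x^{(n+1)})$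 be the $\mathbb P$-probability that, for every $\ell\in\{m,\dots,n+1\}$, $x^{(\ell)}$ is the increasing list of the particles on level $\ell$. Let $\chi(x^{(m)}\prec\cdots\prec x^{(n+1)})$ be $1$ if every $x^{(\ell)}$, $m\le\ell\le n+1$, is strictly increasing with values in $\{0,\dots,n\}$, and $x_i^{(\ell+1)}\le x_i^{(\ell)}\le x_{i+1}^{(\ell+1)}$ for all $m\le\ell\le n$, $1\le i\le\ell$; let it be $0$ otherwise. Call $x_i^{(\ell)}$ even or odd according to the parity of $\ell+x_i^{(\ell)}$, and set $\varepsilon_\ell(y)=(-1)^{\ell+y}$. Let $\alpha^{\rm e}_{\inf},\alpha^{\rm o}_{\inf}$ be the numbers of even, resp. odd, particles on levels $m,\dots,n$ with $x_i^{(\ell)}=x_i^{(\ell+1)}$, let $\alpha^{\rm e}_{\sup},\alpha^{\rm o}_{\sup}$ be the numbers of those with $x_i^{(\ell)}=x_{i+1}^{(\ell+1)}$, let $\alpha=\alpha^{\rm e}_{\inf}+\alpha^{\rm o}_{\inf}+\alpha^{\rm e}_{\sup}+\alpha^{\rm o}_{\sup}$, and $$\Omega(x^{(m)},\dots,x^{(n)})=\frac{(a^2)^{\alpha^{\rm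 o}_{\inf}+\alpha^{\rm e}_{\sup}}\,(b^2)^{\alpha^{\rm e}_{\inf}+\alpha^{\rm o}_{\sup}}}{(a^2+b^2)^{\alpha}}.$$ **Proposition.** $Z_n>0$, and for all nonnegative integer vectors $x^{(\ell)}$ of length $\ell$, $m\le\ell\le n+1$, $$\rho(x^{(m)},\dots,x^{(n+1)})=\frac{(a^2+b^2)^{n(n+1)/2}}{Z_n}\;\tilde\Delta(x^{(m)})\;\Omega(x^{(m)},\dots,x^{(n)})\;\chi(x^{(m)}\prec\cdots\prec x^{(n+1)}),$$ where $$\tilde\Delta(x^{(m)})=\det_{1\le i,j\le m}\left[\frac{(x_i^{(m)})^{j-1}}{(j-1)!}+\varepsilon_m(x_i^{(m)})\sum_{k=0}^{j-2}\frac{(x_i^{(m)})^k}{k!}\,\alpha_{j-2-k}\right].$$ Here, with $v=\frac12\,\frac{b^2-a^2}{a^2+b^2}\in[-\frac12,\frac12]$ and $B_\ell$ the Bernoulli numbers, the coefficients $\alpha_k$ are given by $$\alpha_0=v,\qquad \alpha_k=\sum_{\ell=2}^{k}\left(v\,\alpha_{\ell-2}\,\alpha_{k-\ell}-\frac{2^\ell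 B_\ell}{\ell!}\,\alpha_{k-\ell}\right)\quad(k\ge 1),$$ and their generating function is, for all complex $z\ne 0$ in a neighbourhood of $0$ (principal square root), $$\sum_{k\ge0}\alpha_k z^k=\frac{1-\sqrt{1-4v^2\tanh^2 z}}{2vz\tanh z}\qquad\text{if } v\neq 0,$$ while all $\alpha_k$ vanish if $v=0$. -/

import Mathlib

open Finset Filter Topology

namespace AztecDiamond

/-- Vertices of the dual graph of the Aztec diamond of order `n`, drawn so that the levels are
vertical columns: the points `(X, Y)` with `0 ≤ X, Y ≤ 2n` and `X + Y` odd. -/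
abbrev Vertex (n : ℕ) : Type :=
  {p : Fin (2 * n + 1) × Fin (2 * n + 1) // Odd ((p.1 : ℕ) + (p.2 : ℕ))}

/-- Horizontal coordinate of a vertex. -/
def Vertex.X {n : ℕ} (p : Vertex n) : ℕ := (p.1.1 : ℕ)

/-- Vertical coordinate of a vertex. -/
def Vertex.Y {n : ℕ} (p : Vertex n) : ℕ := (p.1.2 : ℕ)

/-- The dual graph of the Aztec diamond of order `n`: two vertices are joined when both of their
coordinates differ by exactly `1`. -/
def graph (n : ℕ) : SimpleGraph (Vertex n) where
  Adj p q := (p.X = q.X + 1 ∨ q.X = p.X + 1) ∧ (p.Y = q.Y + 1 ∨ q.Y = p.Y + 1)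
  symm := ⟨fun _ _ h => ⟨h.1.symm, h.2.symm⟩⟩
  loopless := ⟨fun p h => by have := h.1; omega⟩

/-- A configuration of the Aztec diamond: a dimer covering (perfect matching) of the dual graph. -/
abbrev Config (n : ℕ) : Type := {M : (graph n).Subgraph // M.IsPerfectMatching}

noncomputable instance (n : ℕ) : Fintype (Config n) := Fintype.ofFinite _

/-- `p` is one of the four corners of the weighted face `(i, j)`, `0 ≤ i, j < n`, whose centre is
the point `(2i + 1, 2j + 1)`. Each edge of the graph borders exactly one weighted face. -/
def IsCorner {n : ℕ} (i j : Fin n) (p : Vertex n) : Prop :=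
  (p.X = 2 * (i : ℕ) + 1 ∧ (p.Y = 2 * (j : ℕ) ∨ p.Y = 2 * (j : ℕ) + 2)) ∨
    (p.Y = 2 * (j : ℕ) + 1 ∧ (p.X = 2 * (i : ℕ) ∨ p.X = 2 * (i : ℕ) + 2))

/-- The number of dimers of the configuration adjacent to the face `(i, j)`. -/
noncomputable def numDimers {n : ℕ} (c : Config n) (i j : Fin n) : ℕ :=
  {e : Sym2 (Vertex n) | e ∈ c.1.edgeSet ∧ ∀ p ∈ e, IsCorner i j p}.ncard

/-- Two-periodic face weights: a chessboard of `a` and `b` with `a` in the bottom-left corner. -/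
def faceWeight (a b : ℝ) {n : ℕ} (i j : Fin n) : ℝ :=
  if Even ((i : ℕ) + (j : ℕ)) then a else b

/-- The two-periodic weight of a configuration. -/
noncomputable def weight (a b : ℝ) {n : ℕ} (c : Config n) : ℝ :=
  ∏ i : Fin n, ∏ j : Fin n, faceWeight a b i j ^ numDimers c i j

/-- The partition function. -/
noncomputable def Z (n : ℕ) (a b : ℝ) : ℝ := ∑ c : Config n, weight a b c

/-- The probability of a configuration. -/
noncomputable def prob (a b : ℝ) {n : ℕ} (c : Config n) : ℝ := weight a b c / Z n a b

/-- Positions of the particles on level `l`. For `1 ≤ l ≤ n` there is a particle at height `k` when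
the vertex `(2l - 1, 2k)` is covered by a dimer going to the right, i.e. towards the column
`X = 2l`. The additional level `n + 1` is completely filled. -/
def particles {n : ℕ} (c : Config n) (l : ℕ) : Set ℕ :=
  if l = n + 1 then {k | k ≤ n}
  else {k | ∃ p q : Vertex n, p.X + 1 = 2 * l ∧ p.Y = 2 * k ∧ q.X = 2 * l ∧ c.1.Adj p q}

/-- A family of positions: `x l i` is the position `x_{i+1}^{(l)}` of the particle number `i + 1`
(from bottom to top) on level `l`. -/
abbrev Positions : Type := (l : ℕ) → Fin l → ℕ

/-- The configuration `c` has on each of the levels `m, …, n + 1` exactly the particles listed, in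
increasing order, by `x`. -/
def Produces {n : ℕ} (c : Config n) (m : ℕ) (x : Positions) : Prop :=
  ∀ l ∈ Finset.Icc m (n + 1), StrictMono (x l) ∧ Set.range (x l) = particles c l

open Classical in
/-- The joint distribution `ρ(x^{(m)}, …, x^{(n+1)})` of the particles on the levels `m` to `n + 1`,
induced by the two-periodic measure on configurations. -/
noncomputable def rho (n : ℕ) (a b : ℝ) (m : ℕ) (x : Positions) : ℝ :=
  ∑ c : Config n with Produces c m x, prob a b c

/-- The interlacing condition `x^{(m)} ≺ ⋯ ≺ x^{(n+1)}`. -/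
def Interlaced (n m : ℕ) (x : Positions) : Prop :=
  (∀ l ∈ Finset.Icc m (n + 1), StrictMono (x l) ∧ ∀ i, x l i ≤ n) ∧
    ∀ l ∈ Finset.Icc m n, ∀ i : Fin l,
      x (l + 1) i.castSucc ≤ x l i ∧ x l i ≤ x (l + 1) i.succ

open Classical in
/-- The interlacing indicator. -/
noncomputable def chi (n m : ℕ) (x : Positions) : ℝ := if Interlaced n m x then 1 else 0

/-- `1` if the particle `x l i` is even and adjacent to its inferior neighbour, else `0`. -/
def infEven (x : Positions) (l : ℕ) (i : Fin l) : ℕ :=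
  if x l i = x (l + 1) i.castSucc ∧ Even (l + x l i) then 1 else 0

/-- `1` if the particle `x l i` is odd and adjacent to its inferior neighbour, else `0`. -/
def infOdd (x : Positions) (l : ℕ) (i : Fin l) : ℕ :=
  if x l i = x (l + 1) i.castSucc ∧ Odd (l + x l i) then 1 else 0

/-- `1` if the particle `x l i` is even and adjacent to its superior neighbour, else `0`. -/
def supEven (x : Positions) (l : ℕ) (i : Fin l) : ℕ :=
  if x l i = x (l + 1) i.succ ∧ Even (l + x l i) then 1 else 0

/-- `1` if the particle `x l i` is odd and adjacent to its superior neighbour, else `0`. -/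
def supOdd (x : Positions) (l : ℕ) (i : Fin l) : ℕ :=
  if x l i = x (l + 1) i.succ ∧ Odd (l + x l i) then 1 else 0

/-- The adjacency function `α = α_inf + α_sup` of the particle `x l i`. -/
def adjacency (x : Positions) (l : ℕ) (i : Fin l) : ℕ :=
  (if x l i = x (l + 1) i.castSucc then 1 else 0) + (if x l i = x (l + 1) i.succ then 1 else 0)

/-- Sum of an adjacency function over all particles on the levels `m` to `n`. -/
def total (m n : ℕ) (f : (l : ℕ) → Fin l → ℕ) : ℕ := ∑ l ∈ Finset.Icc m n, ∑ i : Fin l, f l i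

/-- The factor `Ω(x^{(m)}, …, x^{(n)})`. -/
noncomputable def Omega (a b : ℝ) (m n : ℕ) (x : Positions) : ℝ :=
  (a ^ 2) ^ (total m n (infOdd x) + total m n (supEven x)) *
      (b ^ 2) ^ (total m n (infEven x) + total m n (supOdd x)) /
    (a ^ 2 + b ^ 2) ^ total m n (adjacency x)

/-- The parameter `v`. -/
noncomputable def vParam (a b : ℝ) : ℝ := 1 / 2 * ((b ^ 2 - a ^ 2) / (a ^ 2 + b ^ 2))

/-- The coefficients `α_k`. In the second clause the summation index is `ℓ = r + 2`, and
`k + 1 - ℓ = k - 1 - r`. -/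
noncomputable def alphaCoeff (v : ℝ) : ℕ → ℝ
  | 0 => v
  | k + 1 => ∑ r : Fin k,
      (v * alphaCoeff v (r : ℕ) * alphaCoeff v (k - 1 - (r : ℕ)) -
        2 ^ ((r : ℕ) + 2) * (bernoulli ((r : ℕ) + 2) : ℝ) / (((r : ℕ) + 2).factorial : ℝ) *
          alphaCoeff v (k - 1 - (r : ℕ)))
  decreasing_by all_goals omega

/-- The parity `ε_m(y) = (-1)^{m + y}`. -/
def parity (m y : ℕ) : ℝ := (-1) ^ (m + y)

/-- The modified Vandermonde determinant of the particles `y 0 < ⋯ < y (m - 1)` of level `m`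
(with row and column indices starting at `0`). -/
noncomputable def modVandermonde (v : ℝ) (m : ℕ) (y : Fin m → ℕ) : ℝ :=
  Matrix.det (Matrix.of fun i j : Fin m =>
    (y i : ℝ) ^ (j : ℕ) / ((j : ℕ).factorial : ℝ) +
      parity m (y i) * ∑ k ∈ Finset.range (j : ℕ),
        (y i : ℝ) ^ k / (k.factorial : ℝ) * alphaCoeff v ((j : ℕ) - 1 - k))

end AztecDiamond

/-! Every edge has exactly one end in a column of even abscissa, so a configuration amounts to
choosing, for each of the n vertices of each even column, one of four directions (`Codes`). Once the
particles of all levels are fixed, the columns decouple (`sum_weight_eq_prod`): column l must cover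
on its left exactly the particles of level l, and on its right exactly the holes of level l + 1. The
weighted number of such column matchings is found by adding vertices from bottom to top
(`columnSum_eq`). It vanishes unless the two levels interlace, and is otherwise a product over the
particles of level l (`sum_covers`). This is the case m = 1 (`producedWeight_one`), where the
determinant is 1.

The induction on m sums out the lowest level. Its share of Ω is a product of weights 1 for a free
particle and 1/2 ± v for a particle touching a neighbour, so what is needed is that summing these
weights times the modified Vandermonde determinant over the interlacing positions gives the next
determinant (`modVandermonde_succ`). The row of a particle at x has generating function e^{xz} (1 +
ε U), where U = z ∑ α_k z^k. The recurrence of the α_k says U = v tanh z (1 + U²), and this is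
precisely the condition under which the difference of two rows of level m + 1 is a weighted sum of
rows of level m multiplied by a series z G(z) with G(0) = 1 (`exists_rowSeries_increment`).
Multiplication by G is a unitriangular column operation and leaves the determinant unchanged.

The closed form is the root of the same quadratic equation that is regular at 0: its Taylor
coefficients satisfy the recurrence, which has only one solution. -/

namespace AztecDiamond

/-! ### The coefficients α_k as a formal power series -/

open PowerSeries in
/-- The power series of `z * coth z`. -/
noncomputable def cothSeries (K : Type*) [Field K] [CharZero K] : PowerSeries K :=
  PowerSeries.mk (fun l => 2 ^ l * ((bernoulli l : ℚ) : K) / (l.factorial : K)) + PowerSeries.X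

section Formal

variable {K : Type*} [Field K]

/-- The recurrence defining the coefficients `α_k`. -/
def AlphaRec (v : K) (c : ℕ → K) : Prop :=
  c 0 = v ∧ ∀ k, 1 ≤ k → c k = ∑ l ∈ Finset.Icc 2 k,
    (v * c (l - 2) * c (k - l) -
      2 ^ l * ((bernoulli l : ℚ) : K) / (l.factorial : K) * c (k - l))

theorem AlphaRec.unique {v : K} {c d : ℕ → K} (hc : AlphaRec v c) (hd : AlphaRec v d) (k : ℕ) :
    c k = d k := by
  induction k using Nat.strong_induction_on with
  | _ k ih =>
    rcases Nat.eq_zero_or_pos k with rfl | hk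
    · rw [hc.1, hd.1]
    · rw [hc.2 k hk, hd.2 k hk]
      refine Finset.sum_congr rfl fun l hl => ?_
      rw [Finset.mem_Icc] at hl
      rw [ih (l - 2) (by omega), ih (k - l) (by omega)]

theorem sum_range_eq_Icc_two (f : ℕ → K) {k : ℕ} (hk : 1 ≤ k) :
    ∑ l ∈ Finset.range (k + 1), f l = f 0 + f 1 + ∑ l ∈ Finset.Icc 2 k, f l := by
  induction k, hk using Nat.le_induction with
  | base => simp [Finset.sum_range_succ]
  | succ k hk ih =>
    rw [Finset.sum_range_succ, ih, ← Finset.insert_Icc_right_eq_Icc_add_one (by omega),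
      Finset.sum_insert (by simp)]
    ring

variable [CharZero K]

/-- Comparison of the coefficients of z^k: the terms l = 0, 1 of z coth z are 1 and 0, so the
product on the left is c k plus the Bernoulli sum over l ≥ 2, and the square on the right is the
convolution. -/
theorem alphaRec_iff (v : K) (A : PowerSeries K) :
    AlphaRec v (fun k => PowerSeries.coeff k A) ↔
      A * cothSeries K = PowerSeries.C v + PowerSeries.C v * (PowerSeries.X ^ 2 * A ^ 2) := by
  have h0 : PowerSeries.coeff 0 (cothSeries K) = 1 := by simp [cothSeries]
  -- With the convention B₁ = -1/2, the Bernoulli part is z coth z - z; the added `X` cancels 2 B₁ =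
  -- -1.
  have h1 : PowerSeries.coeff 1 (cothSeries K) = 0 := by
    simp [cothSeries, PowerSeries.coeff_X]; norm_num
  have h2 : ∀ l, 2 ≤ l → PowerSeries.coeff l (cothSeries K) =
      2 ^ l * ((bernoulli l : ℚ) : K) / (l.factorial : K) := by
    intro l hl
    have : l ≠ 1 := by omega
    simp [cothSeries, PowerSeries.coeff_X, this]
  have hL : ∀ k, 1 ≤ k → PowerSeries.coeff k (A * cothSeries K) = PowerSeries.coeff k A +
      ∑ l ∈ Finset.Icc 2 k, 2 ^ l * ((bernoulli l : ℚ) : K) / (l.factorial : K) *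
        PowerSeries.coeff (k - l) A := by
    intro k hk
    rw [mul_comm, PowerSeries.coeff_mul, Finset.Nat.sum_antidiagonal_eq_sum_range_succ
      (fun i j => PowerSeries.coeff i (cothSeries K) * PowerSeries.coeff j A),
      Nat.succ_eq_add_one, sum_range_eq_Icc_two _ hk, h0, h1]
    simp only [one_mul, zero_mul, add_zero, tsub_zero, add_right_inj]
    refine Finset.sum_congr rfl fun l hl => ?_
    rw [h2 l (Finset.mem_Icc.1 hl).1]
  have hR : ∀ k, 1 ≤ k → PowerSeries.coeff k (PowerSeries.X ^ 2 * A ^ 2) =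
      ∑ l ∈ Finset.Icc 2 k, PowerSeries.coeff (l - 2) A * PowerSeries.coeff (k - l) A := by
    intro k hk
    rw [PowerSeries.coeff_X_pow_mul']
    split_ifs with h
    · rw [pow_two, PowerSeries.coeff_mul, Finset.Nat.sum_antidiagonal_eq_sum_range_succ
        (fun i j => PowerSeries.coeff i A * PowerSeries.coeff j A)]
      refine Finset.sum_nbij' (fun i => i + 2) (fun l => l - 2) ?_ ?_ ?_ ?_ ?_
      · intro i hi; rw [Finset.mem_range] at hi; rw [Finset.mem_Icc]; omega
      · intro i hi; rw [Finset.mem_Icc] at hi; rw [Finset.mem_range]; omega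
      · intro i _; simp
      · intro i hi; rw [Finset.mem_Icc] at hi; omega
      · intro i hi
        rw [Nat.add_sub_cancel, show k - 2 - i = k - (i + 2) by omega]
    · rw [Finset.Icc_eq_empty (by omega), Finset.sum_empty]
  rw [PowerSeries.ext_iff]
  unfold AlphaRec
  beta_reduce
  constructor
  · rintro ⟨ha, hb⟩ k
    rcases Nat.eq_zero_or_pos k with rfl | hk
    · have : PowerSeries.constantCoeff (cothSeries K) = 1 := by simpa using h0
      simpa [this] using ha
    · rw [hL k hk, map_add, PowerSeries.coeff_C_mul, hR k hk, hb k hk, PowerSeries.coeff_C,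
        if_neg (by omega), Finset.sum_sub_distrib, Finset.mul_sum]
      simp only [mul_assoc]
      ring
  · intro h
    refine ⟨?_, fun k hk => ?_⟩
    · have h' := h 0
      have : PowerSeries.constantCoeff (cothSeries K) = 1 := by simpa using h0
      simpa [this] using h'
    · have h' := h k
      rw [hL k hk, map_add, PowerSeries.coeff_C_mul, hR k hk, PowerSeries.coeff_C,
        if_neg (by omega), zero_add, Finset.mul_sum] at h'
      rw [Finset.sum_sub_distrib]
      simp only [mul_assoc] at h' ⊢
      rw [← h']
      ring

/-- The Bernoulli generating function at 2z: B(2z) (e^{2z} - 1) = 2z. -/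
theorem cothSeries_mul [Algebra ℚ K] :
    cothSeries K * (PowerSeries.exp K ^ 2 - 1) = PowerSeries.X * (PowerSeries.exp K ^ 2 + 1) := by
  have hB := congrArg (PowerSeries.rescale (2 : K)) (bernoulliPowerSeries_mul_exp_sub_one K)
  have he : PowerSeries.exp K ^ 2 = PowerSeries.rescale (2 : K) (PowerSeries.exp K) := by
    simpa using PowerSeries.exp_pow_eq_rescale_exp (A := K) 2
  rw [map_mul, map_sub, map_one, ← he, PowerSeries.rescale_X] at hB
  have hc : cothSeries K =
      PowerSeries.rescale (2 : K) (bernoulliPowerSeries K) + PowerSeries.X := by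
    unfold cothSeries bernoulliPowerSeries
    rw [PowerSeries.rescale_mk]
    congr 2
    ext l
    simp [mul_div_assoc]
  rw [hc, add_mul, hB]
  have : (PowerSeries.C (2 : K)) = 2 := map_ofNat PowerSeries.C 2
  rw [this]
  ring

/-- The quadratic equation `U = v tanh z (1 + U ^ 2)` of `U = z ∑ α_k z ^ k`, with denominators
cleared. -/
theorem AlphaRec.quadratic [Algebra ℚ K] {v : K} {A : PowerSeries K}
    (h : AlphaRec v (fun k => PowerSeries.coeff k A)) :
    PowerSeries.X * A * (PowerSeries.exp K ^ 2 + 1) =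
      PowerSeries.C v * (PowerSeries.exp K ^ 2 - 1) * (1 + (PowerSeries.X * A) ^ 2) := by
  have h1 := (alphaRec_iff v A).1 h
  have h2 := cothSeries_mul (K := K)
  linear_combination (-A) * h2 + (PowerSeries.exp K ^ 2 - 1) * h1

theorem alphaRec_of_quadratic [Algebra ℚ K] {v : K} {A : PowerSeries K}
    (h : PowerSeries.X * A * (PowerSeries.exp K ^ 2 + 1) =
      PowerSeries.C v * (PowerSeries.exp K ^ 2 - 1) * (1 + (PowerSeries.X * A) ^ 2)) :
    AlphaRec v (fun k => PowerSeries.coeff k A) := by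
  rw [alphaRec_iff]
  have h2 := cothSeries_mul (K := K)
  have h3 : (PowerSeries.exp K ^ 2 - 1) ≠ 0 := by
    intro h0
    have := congrArg (PowerSeries.coeff 1) h0
    rw [pow_two, map_sub, PowerSeries.coeff_mul] at this
    rw [Finset.Nat.sum_antidiagonal_eq_sum_range_succ
      (fun i j => PowerSeries.coeff i (PowerSeries.exp K) * PowerSeries.coeff j (PowerSeries.exp K)),
      Finset.sum_range_succ, Finset.sum_range_succ] at this
    norm_num [PowerSeries.coeff_one, PowerSeries.coeff_exp] at this
  refine mul_right_cancel₀ h3 ?_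
  linear_combination A * h2 + h

end Formal

theorem alphaRec_alphaCoeff (v : ℝ) : AlphaRec v (alphaCoeff v) := by
  refine ⟨by rw [alphaCoeff], fun k hk => ?_⟩
  obtain ⟨k, rfl⟩ := Nat.exists_eq_add_of_le' hk
  rw [alphaCoeff, Fin.sum_univ_eq_sum_range (fun r => v * alphaCoeff v r * alphaCoeff v (k - 1 - r) -
    2 ^ (r + 2) * (bernoulli (r + 2) : ℝ) / ((r + 2).factorial : ℝ) * alphaCoeff v (k - 1 - r)) k]
  refine Finset.sum_nbij' (fun i => i + 2) (fun l => l - 2) ?_ ?_ ?_ ?_ ?_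
  · intro i hi; rw [Finset.mem_range] at hi; rw [Finset.mem_Icc]; omega
  · intro i hi; rw [Finset.mem_Icc] at hi; rw [Finset.mem_range]; omega
  · intro i _; simp
  · intro i hi; rw [Finset.mem_Icc] at hi; omega
  · intro i hi
    rw [Nat.add_sub_cancel, show k - 1 - i = k + 1 - (i + 2) by omega]

theorem alphaCoeff_zero_param (k : ℕ) : alphaCoeff 0 k = 0 := by
  refine (alphaRec_alphaCoeff 0).unique (d := fun _ => 0) ⟨rfl, fun k _ => by simp⟩ k

theorem vParam_mem (a b : ℝ) (ha : 0 < a) : vParam a b ∈ Set.Icc (-(1 / 2) : ℝ) (1 / 2) := by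
  have h : 0 < a ^ 2 + b ^ 2 := by positivity
  rw [vParam, Set.mem_Icc]
  constructor
  · have : -1 ≤ (b ^ 2 - a ^ 2) / (a ^ 2 + b ^ 2) := by
      rw [le_div_iff₀ h]; nlinarith [sq_nonneg b]
    linarith
  · have : (b ^ 2 - a ^ 2) / (a ^ 2 + b ^ 2) ≤ 1 := by
      rw [div_le_iff₀ h]; nlinarith [sq_nonneg a]
    linarith

/-! ### Convergent power series and the closed form of the generating function -/

/-- The power series `p` converges to `f` in a neighbourhood of `0`. -/
def Represents (p : PowerSeries ℂ) (f : ℂ → ℂ) : Prop :=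
  ∀ᶠ z in 𝓝 0, HasSum (fun k => PowerSeries.coeff k p * z ^ k) (f z)

namespace Represents

variable {p q : PowerSeries ℂ} {f g : ℂ → ℂ}

theorem add (hp : Represents p f) (hq : Represents q g) :
    Represents (p + q) (fun z => f z + g z) := by
  filter_upwards [hp, hq] with z h1 h2
  simpa [add_mul] using h1.add h2

theorem mul (hp : Represents p f) (hq : Represents q g) :
    Represents (p * q) (fun z => f z * g z) := by
  filter_upwards [hp, hq] with z h1 h2
  have h := summable_norm_sum_mul_antidiagonal_of_summable_norm h1.summable.norm h2.summable.norm
  have h' := tsum_mul_tsum_eq_tsum_sum_antidiagonal_of_summable_norm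
    h1.summable.norm h2.summable.norm
  rw [h1.tsum_eq, h2.tsum_eq] at h'
  rw [h']
  have e : (fun k => PowerSeries.coeff k (p * q) * z ^ k) = fun k =>
      ∑ x ∈ Finset.HasAntidiagonal.antidiagonal k, PowerSeries.coeff x.1 p * z ^ x.1 *
        (PowerSeries.coeff x.2 q * z ^ x.2) := by
    funext k
    rw [PowerSeries.coeff_mul, Finset.sum_mul]
    refine Finset.sum_congr rfl fun x hx => ?_
    rw [← Finset.HasAntidiagonal.mem_antidiagonal.1 hx, pow_add]
    ring
  rw [e]
  exact h.of_norm.hasSum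

theorem const (c : ℂ) : Represents (PowerSeries.C c) (fun _ => c) := by
  refine Eventually.of_forall fun z => ?_
  convert hasSum_single (f := fun k => PowerSeries.coeff k (PowerSeries.C c) * z ^ k) 0 ?_ using 1
  · simp
  · intro k hk
    simp [PowerSeries.coeff_C, hk]

theorem X : Represents PowerSeries.X (fun z => z) := by
  refine Eventually.of_forall fun z => ?_
  convert hasSum_single (f := fun k => PowerSeries.coeff k (PowerSeries.X) * z ^ k) 1 ?_ using 1
  · simp
  · intro k hk
    simp [PowerSeries.coeff_X, hk]

theorem exp : Represents (PowerSeries.exp ℂ) Complex.exp := by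
  refine Eventually.of_forall fun z => ?_
  have := NormedSpace.expSeries_div_hasSum_exp z
  rw [← Complex.exp_eq_exp_ℂ] at this
  have e : (fun k => PowerSeries.coeff k (PowerSeries.exp ℂ) * z ^ k) =
      fun k => z ^ k / (k.factorial : ℂ) := by
    funext k
    rw [PowerSeries.coeff_exp]
    simp [div_eq_mul_inv, mul_comm]
  rw [e]
  exact this

theorem congr (hp : Represents p f) (h : f =ᶠ[𝓝 0] g) : Represents p g := by
  filter_upwards [hp, h] with z h1 h2
  rwa [← h2]

theorem hasFPowerSeriesAt (hp : Represents p f) :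
    HasFPowerSeriesAt f (FormalMultilinearSeries.ofScalars ℂ fun k => PowerSeries.coeff k p) 0 := by
  rw [hasFPowerSeriesAt_iff]
  filter_upwards [hp] with z h
  simpa [FormalMultilinearSeries.coeff_ofScalars, mul_comm] using h

theorem unique (hp : Represents p f) (hq : Represents q f) : p = q := by
  have h := hp.hasFPowerSeriesAt.eq_formalMultilinearSeries hq.hasFPowerSeriesAt
  have h' := FormalMultilinearSeries.ofScalars_series_injective ℂ (E := ℂ) h
  ext k
  exact congrFun h' k

end Represents

theorem exists_represents {f : ℂ → ℂ} (hf : AnalyticAt ℂ f 0) : ∃ p, Represents p f := by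
  obtain ⟨s, hs⟩ := hf
  rw [hasFPowerSeriesAt_iff] at hs
  refine ⟨PowerSeries.mk s.coeff, ?_⟩
  filter_upwards [hs] with z h
  simpa [mul_comm] using h

theorem cexp_quadratic {v z : ℂ} {U : ℂ} (hc : Complex.cosh z ≠ 0)
    (h : U = v * Complex.tanh z * (1 + U ^ 2)) :
    U * (Complex.exp z ^ 2 + 1) = v * (Complex.exp z ^ 2 - 1) * (1 + U ^ 2) := by
  have he : Complex.exp z * Complex.exp (-z) = 1 := by rw [← Complex.exp_add]; simp
  rw [Complex.tanh_eq_sinh_div_cosh] at h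
  have h' : U * Complex.cosh z = v * Complex.sinh z * (1 + U ^ 2) := by
    nth_rewrite 1 [h]
    field_simp
  have h1 : 2 * Complex.exp z * Complex.cosh z = Complex.exp z ^ 2 + 1 := by
    rw [Complex.cosh]; linear_combination he
  have h2 : 2 * Complex.exp z * Complex.sinh z = Complex.exp z ^ 2 - 1 := by
    rw [Complex.sinh]; linear_combination -he
  rw [← h1, ← h2]
  linear_combination 2 * Complex.exp z * h'

/-- The generating function of the coefficients `α_k`. -/
theorem hasSum_alphaCoeff {v : ℝ} (hv : v ≠ 0) :
    ∀ᶠ z : ℂ in 𝓝[≠] 0, HasSum (fun k : ℕ => (alphaCoeff v k : ℂ) * z ^ k)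
      ((1 - Complex.sqrt (1 - 4 * (v : ℂ) ^ 2 * Complex.tanh z ^ 2)) /
        (2 * (v : ℂ) * z * Complex.tanh z)) := by
  have hcosh : AnalyticAt ℂ Complex.cosh 0 := by fun_prop
  have hsinh : AnalyticAt ℂ Complex.sinh 0 := by fun_prop
  have htanh : AnalyticAt ℂ Complex.tanh 0 := by
    have := hsinh.div hcosh (by simp)
    refine this.congr (Eventually.of_forall fun z => ?_)
    simp [Complex.tanh_eq_sinh_div_cosh]
  -- `dslope` is tanh z / z with the singularity at 0 filled in.
  have hdt : AnalyticAt ℂ (dslope Complex.tanh 0) 0 := by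
    obtain ⟨s, hs⟩ := htanh
    exact ⟨_, hs.has_fpower_series_dslope_fslope⟩
  have hsq : AnalyticAt ℂ (fun z => Complex.sqrt (1 - 4 * (v : ℂ) ^ 2 * Complex.tanh z ^ 2)) 0 := by
    have h1 : AnalyticAt ℂ (fun z => 1 - 4 * (v : ℂ) ^ 2 * Complex.tanh z ^ 2) 0 := by fun_prop
    have : AnalyticAt ℂ (fun z => (1 - 4 * (v : ℂ) ^ 2 * Complex.tanh z ^ 2) ^ (1 / 2 : ℂ)) 0 :=
      h1.cpow analyticAt_const (by simp)
    refine this.congr (Eventually.of_forall fun z => ?_)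
    simp [Complex.sqrt]
  -- The closed form after multiplying numerator and denominator by 1 + √(…): the new denominator is
  -- 2 at the origin, so this version is analytic there.
  have hH : AnalyticAt ℂ (fun z => 2 * (v : ℂ) * dslope Complex.tanh 0 z /
      (1 + Complex.sqrt (1 - 4 * (v : ℂ) ^ 2 * Complex.tanh z ^ 2))) 0 := by
    refine AnalyticAt.div (by fun_prop) (by fun_prop) ?_
    norm_num
  obtain ⟨p, hp⟩ := exists_represents hH
  have hzt : ∀ z, z * dslope Complex.tanh 0 z = Complex.tanh z := fun z => by
    have := sub_smul_dslope Complex.tanh 0 z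
    simpa using this
  have hne : ∀ᶠ z in 𝓝 (0 : ℂ), Complex.cosh z ≠ 0 ∧
      1 + Complex.sqrt (1 - 4 * (v : ℂ) ^ 2 * Complex.tanh z ^ 2) ≠ 0 := by
    refine (hcosh.continuousAt.eventually_ne (by simp)).and ?_
    refine ContinuousAt.eventually_ne (continuousAt_const.add hsq.continuousAt) ?_
    norm_num
  have hs2 : ∀ w : ℂ, Complex.sqrt w ^ 2 = w := fun w => by
    simp [Complex.sqrt]
  have hrec : AlphaRec (v : ℂ) (fun k => PowerSeries.coeff k p) := by
    refine alphaRec_of_quadratic ?_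
    have hU := Represents.X.mul hp
    have hE := Represents.exp.mul Represents.exp
    have hL := hU.mul (hE.add (Represents.const 1))
    have hR := ((Represents.const (v : ℂ)).mul (hE.add (Represents.const (-1)))).mul
      ((Represents.const 1).add (hU.mul hU))
    -- The quadratic equation holds between functions near 0, hence between their expansions, which
    -- are unique.
    have := (hL.congr ?_).unique hR
    · simp only [map_one, map_neg, ← pow_two, ← sub_eq_add_neg] at this
      exact this
    · filter_upwards [hne] with z hz
      obtain ⟨hz1, hz2⟩ := hz
      set S := Complex.sqrt (1 - 4 * (v : ℂ) ^ 2 * Complex.tanh z ^ 2) with hS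
      have hS2 : S ^ 2 = 1 - 4 * (v : ℂ) ^ 2 * Complex.tanh z ^ 2 := hs2 _
      have hUz : z * (2 * (v : ℂ) * dslope Complex.tanh 0 z / (1 + S)) =
          2 * (v : ℂ) * Complex.tanh z / (1 + S) := by
        rw [← hzt z]; ring
      have := cexp_quadratic (v := v) (z := z) (U := 2 * (v : ℂ) * Complex.tanh z / (1 + S)) hz1 (by
        field_simp
        linear_combination (-(v : ℂ) * Complex.tanh z) * hS2)
      rw [hUz]
      linear_combination this
  have hcoef : ∀ k, PowerSeries.coeff k p = (alphaCoeff v k : ℂ) := by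
    refine hrec.unique (d := fun k => (alphaCoeff v k : ℂ)) ⟨?_, fun k hk => ?_⟩
    · beta_reduce
      exact_mod_cast (alphaRec_alphaCoeff v).1
    · beta_reduce
      rw [(alphaRec_alphaCoeff v).2 k hk]
      push_cast
      rfl
  have htne : ∀ᶠ z in 𝓝[≠] (0 : ℂ), Complex.sinh z ≠ 0 := by
    rcases hsinh.eventually_eq_zero_or_eventually_ne_zero with h | h
    · exfalso
      have hd : deriv Complex.sinh 0 = 0 := by
        rw [Filter.EventuallyEq.deriv_eq (f := fun _ => (0 : ℂ)) h]
        simp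
      simp at hd
    · exact h
  have hne' := hne.filter_mono (nhdsWithin_le_nhds (s := {0}ᶜ))
  have hp' := Filter.Eventually.filter_mono (nhdsWithin_le_nhds (s := {0}ᶜ)) hp
  filter_upwards [hne', hp', htne, self_mem_nhdsWithin] with z hz hpz hsz hz0
  have hz0 : z ≠ 0 := hz0
  have ht0 : Complex.tanh z ≠ 0 := by
    rw [Complex.tanh_eq_sinh_div_cosh]; exact div_ne_zero hsz hz.1
  simp only [hcoef] at hpz
  convert hpz using 1
  have hd : dslope Complex.tanh 0 z = Complex.tanh z / z := by
    rw [← hzt z]; field_simp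
  have hS2 := hs2 (1 - 4 * (v : ℂ) ^ 2 * Complex.tanh z ^ 2)
  have hv' : (v : ℂ) ≠ 0 := by exact_mod_cast hv
  have hz2 := hz.2
  rw [hd]
  set S := Complex.sqrt (1 - 4 * (v : ℂ) ^ 2 * Complex.tanh z ^ 2)
  rw [div_eq_div_iff (by simp [hv', hz0, ht0]) hz2]
  field_simp
  linear_combination (-1 : ℂ) * hS2

/-! ### Row generating functions and summation over one level -/

/-- The entries of the matrix defining `modVandermonde`. -/
noncomputable def vandermondeEntry (v : ℝ) (m x j : ℕ) : ℝ :=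
  (x : ℝ) ^ j / (j.factorial : ℝ) +
    parity m x * ∑ k ∈ Finset.range j, (x : ℝ) ^ k / (k.factorial : ℝ) * alphaCoeff v (j - 1 - k)

theorem modVandermonde_eq (v : ℝ) (m : ℕ) (y : Fin m → ℕ) :
    modVandermonde v m y = Matrix.det (Matrix.of fun i j : Fin m => vandermondeEntry v m (y i) j) :=
  rfl

/-- The power series `∑ α_k z ^ k`. -/
noncomputable def alphaSeries (v : ℝ) : PowerSeries ℝ := PowerSeries.mk (alphaCoeff v)

theorem alphaSeries_quadratic (v : ℝ) :
    PowerSeries.X * alphaSeries v * (PowerSeries.exp ℝ ^ 2 + 1) =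
      PowerSeries.C v * (PowerSeries.exp ℝ ^ 2 - 1) * (1 + (PowerSeries.X * alphaSeries v) ^ 2) := by
  refine AlphaRec.quadratic ?_
  simpa [alphaSeries] using alphaRec_alphaCoeff v

/-- The generating function of a row of the matrix defining `modVandermonde`. -/
noncomputable def rowSeries (v : ℝ) (m x : ℕ) : PowerSeries ℝ :=
  PowerSeries.exp ℝ ^ x * (1 + PowerSeries.C (parity m x) * (PowerSeries.X * alphaSeries v))

theorem coeff_exp_pow (x j : ℕ) :
    PowerSeries.coeff j (PowerSeries.exp ℝ ^ x) = (x : ℝ) ^ j / (j.factorial : ℝ) := by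
  rw [PowerSeries.exp_pow_eq_rescale_exp, PowerSeries.coeff_rescale, PowerSeries.coeff_exp]
  simp [div_eq_mul_inv]

theorem coeff_rowSeries (v : ℝ) (m x j : ℕ) :
    PowerSeries.coeff j (rowSeries v m x) = vandermondeEntry v m x j := by
  have h : rowSeries v m x = PowerSeries.exp ℝ ^ x + PowerSeries.C (parity m x) *
      (PowerSeries.X * (PowerSeries.exp ℝ ^ x * alphaSeries v)) := by
    rw [rowSeries]; ring
  rw [h, map_add, PowerSeries.coeff_C_mul, coeff_exp_pow, vandermondeEntry]
  congr 2
  cases j with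
  | zero => simp
  | succ j =>
    rw [PowerSeries.coeff_succ_X_mul, PowerSeries.coeff_mul,
      Finset.Nat.sum_antidiagonal_eq_sum_range_succ (fun i j =>
        PowerSeries.coeff i (PowerSeries.exp ℝ ^ x) * PowerSeries.coeff j (alphaSeries v))]
    refine Finset.sum_congr rfl fun k _ => ?_
    rw [coeff_exp_pow]
    simp [alphaSeries]

theorem parity_succ_right (m x : ℕ) : parity m (x + 1) = -parity m x := by
  rw [parity, parity, ← add_assoc, pow_succ]; ring

theorem parity_succ_left (m x : ℕ) : parity (m + 1) x = -parity m x := by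
  rw [parity, parity, show m + 1 + x = m + x + 1 by ring, pow_succ]; ring

theorem parity_sq (m x : ℕ) : parity m x ^ 2 = 1 := by
  rw [parity, ← pow_mul, mul_comm, pow_mul]; simp

/-- The increment of the summation operator between two consecutive heights. -/
noncomputable def increment (v : ℝ) (m : ℕ) (f : ℕ → ℝ) (x : ℕ) : ℝ :=
  1 / 2 * (f x + f (x + 1)) + v * (parity m x * f x - parity m (x + 1) * f (x + 1))

/-- Write E = e^z and s = ε_m(x). The left side is E^x ((E - 1) + s U (E + 1)), and the bracket on
the right is E^x (D₁ + s D₂). One series g = z G must therefore satisfy both g D₁ = E - 1 and g D₂ =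
(E + 1) U. The first determines g because D₁ has constant term 1; the compatibility (E - 1) D₂ = (E
+ 1) U D₁ is exactly the quadratic equation of U. -/
theorem exists_rowSeries_increment (v : ℝ) : ∃ G : PowerSeries ℝ,
    PowerSeries.coeff 0 G = 1 ∧ ∀ m x, rowSeries v (m + 1) (x + 1) - rowSeries v (m + 1) x =
      PowerSeries.X * G * (PowerSeries.C (1 / 2) * (rowSeries v m x + rowSeries v m (x + 1)) +
        PowerSeries.C v * (PowerSeries.C (parity m x) * rowSeries v m x -
          PowerSeries.C (parity m (x + 1)) * rowSeries v m (x + 1))) := by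
  set E := PowerSeries.exp ℝ with hE
  set U := PowerSeries.X * alphaSeries v with hU
  set D₁ := PowerSeries.C (1 / 2) * (1 + E) + PowerSeries.C v * U * (1 - E) with hD₁
  set D₂ := PowerSeries.C (1 / 2) * U * (1 - E) + PowerSeries.C v * (1 + E) with hD₂
  have hC : PowerSeries.C (1 / 2 : ℝ) * 2 = 1 := by
    rw [← map_ofNat PowerSeries.C 2, ← map_mul, ← map_one PowerSeries.C]; norm_num
  have hD0 : PowerSeries.constantCoeff D₁ = 1 := by
    simp [hD₁, hU, hE]; norm_num
  have hD : D₁ ≠ 0 := by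
    intro h; rw [h] at hD0; simp at hD0
  have hinv : D₁ * D₁⁻¹ = 1 := PowerSeries.mul_inv_cancel _ (by rw [hD0]; exact one_ne_zero)
  obtain ⟨H, hH⟩ : PowerSeries.X ∣ E - 1 := by
    rw [PowerSeries.X_dvd_iff]; simp [hE]
  have hH0 : PowerSeries.coeff 0 H = 1 := by
    rw [← PowerSeries.coeff_succ_X_mul, ← hH]
    simp [hE, PowerSeries.coeff_exp, PowerSeries.coeff_one]
  have hg1 : PowerSeries.X * (H * D₁⁻¹) * D₁ = E - 1 := by
    rw [hH]; linear_combination (PowerSeries.X * H) * hinv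
  have hquad := alphaSeries_quadratic v
  rw [← hE, ← hU] at hquad
  have hg2 : PowerSeries.X * (H * D₁⁻¹) * D₂ = (E + 1) * U := by
    refine mul_right_cancel₀ hD ?_
    linear_combination D₂ * hg1 - 2 * PowerSeries.C (1 / 2 : ℝ) * hquad -
      (PowerSeries.C v * (E ^ 2 - 1) * (1 + U ^ 2)) * hC
  refine ⟨H * D₁⁻¹, ?_, fun m x => ?_⟩
  · rw [PowerSeries.coeff_zero_eq_constantCoeff, map_mul, PowerSeries.constantCoeff_inv, hD0,
      ← PowerSeries.coeff_zero_eq_constantCoeff_apply, hH0]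
    simp
  · have hs : PowerSeries.C (parity m x) ^ 2 = 1 := by rw [← map_pow, parity_sq, map_one]
    simp only [rowSeries, parity_succ_left, parity_succ_right, map_neg, neg_neg]
    rw [← hE, ← hU, pow_succ]
    set s := PowerSeries.C (parity m x)
    set g := PowerSeries.X * (H * D₁⁻¹)
    linear_combination (-E ^ x) * hg1 - s * E ^ x * hg2 +
      (E ^ x * g * PowerSeries.C v * U * (E - 1)) * hs

/-- Extraction of the coefficient of z^{j+1}: the factor z shifts the column by one, so only columns
k ≤ j of level m occur, with coefficient `G 0 = 1` at k = j. -/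
theorem exists_vandermondeEntry_increment (v : ℝ) : ∃ G : ℕ → ℝ, G 0 = 1 ∧ ∀ m x j,
    vandermondeEntry v (m + 1) (x + 1) (j + 1) - vandermondeEntry v (m + 1) x (j + 1) =
      ∑ k ∈ Finset.range (j + 1),
        increment v m (fun y => vandermondeEntry v m y k) x * G (j - k) := by
  obtain ⟨G, hG0, hG⟩ := exists_rowSeries_increment v
  refine ⟨fun k => PowerSeries.coeff k G, hG0, fun m x j => ?_⟩
  rw [← coeff_rowSeries, ← coeff_rowSeries, ← map_sub, hG, mul_assoc,
    PowerSeries.coeff_succ_X_mul, mul_comm, PowerSeries.coeff_mul,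
    Finset.Nat.sum_antidiagonal_eq_sum_range_succ_mk]
  refine Finset.sum_congr rfl fun k _ => ?_
  simp only [map_add, map_sub, PowerSeries.coeff_C_mul, coeff_rowSeries, increment]

/-- The weight of a particle at `x` between its inferior neighbour `y` and its superior
neighbour `y'`. -/
noncomputable def siteWeight (v : ℝ) (m y y' x : ℕ) : ℝ :=
  1 + (if x = y then -(1 / 2) + v * parity m y else 0) +
    (if x = y' then -(1 / 2) - v * parity m y' else 0)

/-- A trapezoidal rule: an interior point receives 1/2 from both sides and its v-terms cancel, while
the end points keep 1/2 + v ε(y) and 1/2 - v ε(y'). For y = y' the two corrections in `siteWeight`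
add up to -1, so that both sides vanish. -/
theorem sum_increment (v : ℝ) (m : ℕ) (f : ℕ → ℝ) {y y' : ℕ} (h : y ≤ y') :
    ∑ x ∈ Finset.Ico y y', increment v m f x =
      ∑ x ∈ Finset.Icc y y', siteWeight v m y y' x * f x := by
  have key : ∑ x ∈ Finset.Ico y y', increment v m f x = ∑ x ∈ Finset.Icc y y', f x +
      (-(1 / 2) + v * parity m y) * f y + (-(1 / 2) - v * parity m y') * f y' := by
    induction y', h using Nat.le_induction with
    | base => simp; ring
    | succ k hk ih =>
      rw [Finset.sum_Ico_succ_top hk, ih, ← Finset.insert_Icc_right_eq_Icc_add_one (by omega),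
        Finset.sum_insert (by simp), increment]
      ring
  rw [key]
  simp only [siteWeight, add_mul, Finset.sum_add_distrib, ite_mul, zero_mul, one_mul]
  simp [h]

theorem det_eq_det_sub {R : Type*} [CommRing R] {m : ℕ} (N : Matrix (Fin (m + 1)) (Fin (m + 1)) R)
    (h : ∀ i, N i 0 = 1) :
    N.det = (Matrix.of fun i j : Fin m => N i.succ j.succ - N i.castSucc j.succ).det := by
  set B : Matrix (Fin (m + 1)) (Fin (m + 1)) R :=
    Matrix.of fun i j => Fin.cases (N 0 j) (fun i => N i.succ j - N i.castSucc j) i with hB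
  rw [Matrix.det_eq_of_forall_row_eq_smul_add_pred (B := B) (fun _ => 1) (by simp [hB])
    (by simp [hB]), Matrix.det_succ_column_zero, Fin.sum_univ_succ, Finset.sum_eq_zero]
  · simp only [hB, Matrix.of_apply, Fin.cases_zero, h]
    simp
    congr 1
  · intro i _
    simp [hB, h]

theorem det_sum_rows {m : ℕ} (t : Fin m → Finset ℕ) (w : Fin m → ℕ → ℝ) (f : ℕ → Fin m → ℝ) :
    (Matrix.of fun i j : Fin m => ∑ x ∈ t i, w i x * f x j).det =
      ∑ y ∈ Fintype.piFinset t, (∏ i, w i (y i)) * (Matrix.of fun i j : Fin m => f (y i) j).det := by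
  have h := (Matrix.detRowAlternating (R := ℝ) (n := Fin m)).toMultilinearMap.map_sum_finset
    (fun i x => w i x • f x) t
  have hl : (Matrix.of fun i j : Fin m => ∑ x ∈ t i, w i x * f x j) =
      Matrix.of fun i => ∑ x ∈ t i, w i x • f x := by
    ext i j
    simp [Finset.sum_apply]
  rw [hl]
  refine Eq.trans h (Finset.sum_congr rfl fun y _ => ?_)
  exact (Matrix.detRowAlternating (R := ℝ) (n := Fin m)).toMultilinearMap.map_smul_univ
    (fun i => w i (y i)) (fun i => f (y i))

/-- Summing the modified Vandermonde determinant over a level interlaced with the next one gives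
the modified Vandermonde determinant of the next level. -/
theorem modVandermonde_succ (v : ℝ) (m : ℕ) (z : Fin (m + 1) → ℕ) (hz : Monotone z) :
    modVandermonde v (m + 1) z =
      ∑ y ∈ Fintype.piFinset fun i : Fin m => Finset.Icc (z i.castSucc) (z i.succ),
        (∏ i, siteWeight v m (z i.castSucc) (z i.succ) (y i)) * modVandermonde v m y := by
  obtain ⟨G, hG0, hG⟩ := exists_vandermondeEntry_increment v
  have hdiff : ∀ y y' j : ℕ, y ≤ y' →
      vandermondeEntry v (m + 1) y' (j + 1) - vandermondeEntry v (m + 1) y (j + 1) =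
        ∑ k ∈ Finset.range (j + 1), (∑ x ∈ Finset.Icc y y',
          siteWeight v m y y' x * vandermondeEntry v m x k) * G (j - k) := by
    intro y y' j h
    rw [← Finset.sum_Ico_sub (fun x => vandermondeEntry v (m + 1) x (j + 1)) h]
    simp only [hG]
    rw [Finset.sum_comm]
    refine Finset.sum_congr rfl fun k _ => ?_
    rw [← Finset.sum_mul, sum_increment v m (fun x => vandermondeEntry v m x k) h]
  -- Multiplication of the row series by G, as a unitriangular matrix acting on the columns.
  set L : Matrix (Fin m) (Fin m) ℝ :=
    Matrix.of fun k j : Fin m => if (k : ℕ) ≤ j then G ((j : ℕ) - k) else 0 with hL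
  have hdetL : L.det = 1 := by
    rw [Matrix.det_of_isUpperTriangular]
    · simp [hL, hG0]
    · intro i j hij
      have : ¬ (i : ℕ) ≤ j := not_le.2 hij
      simp only [hL, Matrix.of_apply, if_neg this]
  rw [modVandermonde_eq, det_eq_det_sub _ (by intro i; simp [vandermondeEntry])]
  simp only [modVandermonde_eq]
  rw [← det_sum_rows (fun i : Fin m => Finset.Icc (z i.castSucc) (z i.succ))
    (fun i => siteWeight v m (z i.castSucc) (z i.succ)) (fun x j => vandermondeEntry v m x j)]
  rw [← mul_one (Matrix.det (Matrix.of fun i j : Fin m => ∑ x ∈ _, _)), ← hdetL, ← Matrix.det_mul]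
  congr 1
  ext i j
  rw [Matrix.mul_apply]
  simp only [Matrix.of_apply, Fin.val_succ, hL]
  rw [hdiff _ _ _ (hz (Fin.castSucc_le_succ i)), 
    Fin.sum_univ_eq_sum_range (fun k => (∑ x ∈ Finset.Icc (z i.castSucc) (z i.succ),
      siteWeight v m (z i.castSucc) (z i.succ) x * vandermondeEntry v m x k) *
        if k ≤ (j : ℕ) then G ((j : ℕ) - k) else 0) m]
  have hsub : Finset.range ((j : ℕ) + 1) ⊆ Finset.range m := by
    intro k hk
    rw [Finset.mem_range] at hk ⊢
    omega
  rw [← Finset.sum_subset hsub]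
  · refine Finset.sum_congr rfl fun k hk => ?_
    rw [Finset.mem_range] at hk
    rw [if_pos (by omega)]
  · intro k _ hk
    rw [Finset.mem_range] at hk
    rw [if_neg (by omega), mul_zero]

/-! ### Weighted matchings of a single column -/

/-- The chessboard weights along a diagonal index. -/
def chess (a b : ℝ) (k : ℕ) : ℝ := if Even k then a else b

theorem chess_add_two (a b : ℝ) (k : ℕ) : chess a b (k + 2) = chess a b k := by
  simp [chess, Nat.even_add]

theorem chess_mul_succ (a b : ℝ) (k : ℕ) : chess a b k * chess a b (k + 1) = a * b := by
  by_cases h : Even k <;> simp [chess, Nat.even_add_one, h, mul_comm]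

theorem chess_sq_add (a b : ℝ) (k : ℕ) : chess a b k ^ 2 + chess a b (k + 1) ^ 2 = a ^ 2 + b ^ 2 := by
  by_cases h : Even k <;> simp [chess, Nat.even_add_one, h, add_comm]

theorem chess_pos {a b : ℝ} (ha : 0 < a) (hb : 0 < b) (k : ℕ) : 0 < chess a b k := by
  unfold chess; split_ifs <;> assumption

/-- A column of vertices, the `k`-th one lying between the heights `k` and `k + 1`, is matched with
its neighbours: the first component of `t k` tells whether to the right, the second one whether
upwards. This is the number of those matched with the vertex at height `h` on side `s`. -/
def hits {N : ℕ} (t : Fin N → Bool × Bool) (s : Bool) (h : ℕ) : ℕ :=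
  ∑ k : Fin N, if (t k).1 = s ∧ (k : ℕ) + (t k).2.toNat = h then 1 else 0

theorem hits_snoc {N : ℕ} (t : Fin N → Bool × Bool) (r u s : Bool) (h : ℕ) :
    hits (Fin.snoc t (r, u) : Fin (N + 1) → Bool × Bool) s h =
      hits t s h + if r = s ∧ N + u.toNat = h then 1 else 0 := by
  unfold hits
  rw [Fin.sum_univ_castSucc]
  simp only [Fin.snoc_castSucc, Fin.snoc_last, Fin.val_castSucc, Fin.val_last]

theorem hits_eq_zero {N : ℕ} (t : Fin N → Bool × Bool) (s : Bool) {h : ℕ} (hh : N < h) :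
    hits t s h = 0 := by
  refine Finset.sum_eq_zero fun k _ => if_neg ?_
  have := Bool.toNat_le (t k).2
  omega

/-- The weight of the matching `t` of the column with index `l`. -/
noncomputable def columnWeight (a b : ℝ) (l : ℕ) {N : ℕ} (t : Fin N → Bool × Bool) : ℝ :=
  ∏ k : Fin N, chess a b (l + k + (t k).1.toNat + 1)

theorem columnWeight_snoc (a b : ℝ) (l : ℕ) {N : ℕ} (t : Fin N → Bool × Bool) (r u : Bool) :
    columnWeight a b l (Fin.snoc t (r, u) : Fin (N + 1) → Bool × Bool) =
      chess a b (l + N + r.toNat + 1) * columnWeight a b l t := by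
  simp [columnWeight, Fin.prod_univ_castSucc, mul_comm]

/-- Below height `N`, the matching `t` uses exactly the vertices at heights in `A` on the left and
not in `B` on the right, each once. -/
def Covers {N : ℕ} (A B : Finset ℕ) (M : ℕ) (t : Fin N → Bool × Bool) : Prop :=
  ∀ h < M, hits t false h = (if h ∈ A then 1 else 0) ∧ hits t true h = if h ∈ B then 0 else 1

instance {N : ℕ} (A B : Finset ℕ) (M : ℕ) (t : Fin N → Bool × Bool) :
    Decidable (Covers A B M t) := by unfold Covers; infer_instance

/-- Weighted sum over the partial matchings of a column of length `N` which are exact below height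
`N` and have prescribed numbers of hits at height `N`. -/
noncomputable def columnSum (a b : ℝ) (l : ℕ) (A B : Finset ℕ) (N p q : ℕ) : ℝ :=
  ∑ t : Fin N → Bool × Bool,
    if Covers A B N t ∧ hits t false N = p ∧ hits t true N = q then columnWeight a b l t else 0

theorem covers_snoc {N : ℕ} (A B : Finset ℕ) (t : Fin N → Bool × Bool) (r u : Bool) :
    Covers A B (N + 1) (Fin.snoc t (r, u) : Fin (N + 1) → Bool × Bool) ↔
      Covers A B N t ∧
      (hits t false N + if r = false ∧ u = false then 1 else 0) = (if N ∈ A then 1 else 0) ∧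
      (hits t true N + if r = true ∧ u = false then 1 else 0) = if N ∈ B then 0 else 1 := by
  unfold Covers
  constructor
  · intro h
    refine ⟨fun k hk => ?_, ?_⟩
    · have := h k (by omega)
      rwa [hits_snoc, hits_snoc, if_neg (fun h => by omega : ¬ (r = false ∧ N + u.toNat = k)),
        if_neg (fun h => by omega : ¬ (r = true ∧ N + u.toNat = k)), add_zero, add_zero] at this
    · have := h N (by omega)
      rw [hits_snoc, hits_snoc] at this
      cases u <;> simpa using this
  · rintro ⟨h1, h2⟩ k hk
    rcases Nat.lt_succ_iff_lt_or_eq.1 hk with hk | rfl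
    · rw [hits_snoc, hits_snoc, if_neg (fun h => by omega : ¬ (r = false ∧ N + u.toNat = k)),
        if_neg (fun h => by omega : ¬ (r = true ∧ N + u.toNat = k))]
      exact h1 k hk
    · rw [hits_snoc, hits_snoc]
      cases u <;> simpa using h2

theorem columnSum_zero (a b : ℝ) (l : ℕ) (A B : Finset ℕ) (p q : ℕ) :
    columnSum a b l A B 0 p q = if p = 0 ∧ q = 0 then 1 else 0 := by
  simp [columnSum, Covers, hits, columnWeight, @eq_comm ℕ 0]

/-- Removal of the top vertex: the four terms are the directions left-up, right-up, left-down and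
right-down. An upward dimer makes the only hit at height N + 1; a downward one supplies one of the
hits required at height N. -/
theorem columnSum_succ (a b : ℝ) (l : ℕ) (A B : Finset ℕ) (N p q : ℕ) :
    columnSum a b l A B (N + 1) p q =
      (if p = 1 ∧ q = 0 then chess a b (l + N + 1) *
        columnSum a b l A B N (if N ∈ A then 1 else 0) (if N ∈ B then 0 else 1) else 0) +
      (if p = 0 ∧ q = 1 then chess a b (l + N + 2) *
        columnSum a b l A B N (if N ∈ A then 1 else 0) (if N ∈ B then 0 else 1) else 0) +
      (if p = 0 ∧ q = 0 ∧ N ∈ A then chess a b (l + N + 1) *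
        columnSum a b l A B N 0 (if N ∈ B then 0 else 1) else 0) +
      (if p = 0 ∧ q = 0 ∧ N ∉ B then chess a b (l + N + 2) *
        columnSum a b l A B N (if N ∈ A then 1 else 0) 0 else 0) := by
  have hsum : columnSum a b l A B (N + 1) p q = ∑ ru : Bool × Bool, ∑ t : Fin N → Bool × Bool,
      if Covers A B (N + 1) (Fin.snoc t ru : Fin (N + 1) → Bool × Bool) ∧
        hits (Fin.snoc t ru : Fin (N + 1) → Bool × Bool) false (N + 1) = p ∧
        hits (Fin.snoc t ru : Fin (N + 1) → Bool × Bool) true (N + 1) = q then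
      columnWeight a b l (Fin.snoc t ru : Fin (N + 1) → Bool × Bool) else 0 := by
    rw [← Fintype.sum_prod_type']
    exact (Fintype.sum_equiv (Fin.snocEquiv fun _ => Bool × Bool) _ _ fun _ => rfl).symm
  rw [hsum, Fintype.sum_prod_type]
  simp only [Fintype.sum_bool, covers_snoc, hits_snoc, columnWeight_snoc,
    hits_eq_zero _ _ (Nat.lt_succ_self N)]
  have e1 : ∀ (P : Prop) [Decidable P] (c : ℝ) (p' q' : ℕ),
      (if P then c * columnSum a b l A B N p' q' else 0) = ∑ t : Fin N → Bool × Bool,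
        if P ∧ Covers A B N t ∧ hits t false N = p' ∧ hits t true N = q'
          then c * columnWeight a b l t else 0 := by
    intro P _ c p' q'
    by_cases hP : P
    · simp [hP, columnSum, Finset.mul_sum]
    · simp [hP]
  rw [e1, e1, e1, e1]
  -- Matches the order of the sum over `Bool × Bool` (right before left, up before down) with the
  -- order of the four terms in the statement.
  have e2 : ∀ x y z w x' y' z' w' : ℝ, x = y' → y = w' → z = x' → w = z' →
      x + y + (z + w) = x' + y' + z' + w' := by
    intros; subst_vars; ring
  refine e2 _ _ _ _ _ _ _ _ ?_ ?_ ?_ ?_ <;> refine Finset.sum_congr rfl fun t _ => ?_ <;>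
    refine if_congr ?_ (by simp) rfl <;> by_cases hA : N ∈ A <;> by_cases hB : N ∈ B <;>
    simp [hA, hB] <;> grind

/-- The number of particles of `B` below height `j` minus that of `A`. -/
def excess (A B : Finset ℕ) (j : ℕ) : ℤ :=
  ((B.filter (· < j)).card : ℤ) - ((A.filter (· < j)).card : ℤ)

theorem card_filter_lt_succ (A : Finset ℕ) (j : ℕ) :
    (A.filter (· < j + 1)).card = (A.filter (· < j)).card + if j ∈ A then 1 else 0 := by
  split_ifs with h
  · have : A.filter (· < j + 1) = insert j (A.filter (· < j)) := by
      ext x; simp only [Finset.mem_filter, Finset.mem_insert]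
      constructor
      · rintro ⟨h1, h2⟩
        rcases Nat.lt_succ_iff_lt_or_eq.1 h2 with h3 | h3
        · exact Or.inr ⟨h1, h3⟩
        · exact Or.inl h3
      · rintro (rfl | ⟨h1, h2⟩)
        · exact ⟨h, by omega⟩
        · exact ⟨h1, by omega⟩
    rw [this, Finset.card_insert_of_notMem (by simp)]
  · rw [add_zero]
    congr 1
    refine Finset.filter_congr fun x hx => ?_
    have : x ≠ j := fun e => h (e ▸ hx)
    omega

theorem excess_succ (A B : Finset ℕ) (j : ℕ) :
    excess A B (j + 1) = excess A B j + (if j ∈ B then 1 else 0) - if j ∈ A then 1 else 0 := by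
  rw [excess, excess, card_filter_lt_succ, card_filter_lt_succ]
  push_cast
  ring

theorem excess_zero (A B : Finset ℕ) : excess A B 0 = 0 := by simp [excess]

/-- The contribution of a particle at height `j` of the level `A`, relative to that of a hole. -/
noncomputable def siteFactor (a b : ℝ) (l : ℕ) (A B : Finset ℕ) (j : ℕ) : ℝ :=
  if j ∈ A then (if j ∈ B then
    (if excess A B j = 0 then chess a b (l + j + 1) ^ 2 else chess a b (l + j) ^ 2)
      else a ^ 2 + b ^ 2) / (a * b) else 1

/-- The common value of the nonzero column sums. -/
noncomputable def columnProd (a b : ℝ) (l : ℕ) (A B : Finset ℕ) (N : ℕ) : ℝ :=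
  ∏ j ∈ Finset.range N, (chess a b (l + j) * siteFactor a b l A B j)

/-- Counting the N vertices by their partners gives p + q = `excess A B N`, and p + q ≤ 1 because
only the top vertex reaches height N; hence the excess stays in {0, 1}. When it is 1, turning the
top vertex from right to left exchanges the states (0, 1) and (1, 0) and replaces the weight `chess
a b (l + N + 1)` by `chess a b (l + N)`, whence the ratio. -/
theorem columnSum_eq {a b : ℝ} (ha : 0 < a) (hb : 0 < b) (l : ℕ) (A B : Finset ℕ) (N p q : ℕ) :
    columnSum a b l A B N p q =
      if ∀ j ≤ N, excess A B j = 0 ∨ excess A B j = 1 then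
        (if excess A B N = 0 then (if p = 0 ∧ q = 0 then columnProd a b l A B N else 0)
        else (if p = 0 ∧ q = 1 then columnProd a b l A B N
          else if p = 1 ∧ q = 0 then
            columnProd a b l A B N * (chess a b (l + N) / chess a b (l + N + 1)) else 0))
      else 0 := by
  induction N generalizing p q with
  | zero =>
    rw [columnSum_zero]
    simp [excess_zero, columnProd]
  | succ N ih =>
    have hok : (∀ j ≤ N + 1, excess A B j = 0 ∨ excess A B j = 1) ↔
        (∀ j ≤ N, excess A B j = 0 ∨ excess A B j = 1) ∧
          (excess A B (N + 1) = 0 ∨ excess A B (N + 1) = 1) := by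
      constructor
      · intro h; exact ⟨fun j hj => h j (by omega), h _ le_rfl⟩
      · rintro ⟨h1, h2⟩ j hj
        rcases Nat.le_succ_iff.1 hj with h | rfl
        · exact h1 j h
        · exact h2
    rw [columnSum_succ]
    simp only [ih, hok]
    by_cases hN : ∀ j ≤ N, excess A B j = 0 ∨ excess A B j = 1
    swap
    · simp [hN]
    have hprod : columnProd a b l A B (N + 1) =
        columnProd a b l A B N * (chess a b (l + N) * siteFactor a b l A B N) := by
      rw [columnProd, Finset.prod_range_succ, ← columnProd]
    have hx := chess_pos ha hb (l + N)
    have hy := chess_pos ha hb (l + N + 1)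
    have hz := chess_add_two a b (l + N)
    have hw : chess a b (l + (N + 1)) = chess a b (l + N + 1) := rfl
    have hw' : chess a b (l + (N + 1) + 1) = chess a b (l + N + 2) := rfl
    have hxy := chess_mul_succ a b (l + N)
    have hsq := chess_sq_add a b (l + N)
    rw [hprod, excess_succ, siteFactor, hw, hw', hz, ← hxy, ← hsq]
    have hN' : (∀ j ≤ N, excess A B j = 0 ∨ excess A B j = 1) = True := eq_true hN
    simp only [hN', true_and]
    set x := chess a b (l + N)
    set y := chess a b (l + N + 1)
    set K := columnProd a b l A B N
    rcases hN N le_rfl with hD | hD <;> by_cases hA : N ∈ A <;> by_cases hB : N ∈ B <;>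
      simp only [hA, hB, hD] <;> norm_num <;> split_ifs <;>
      first | rfl | omega | (try simp only [add_zero, zero_add]) <;> field_simp <;> ring

/-- The weighted sum over the matchings of a whole column, given the particles on both sides. -/
theorem sum_covers {a b : ℝ} (ha : 0 < a) (hb : 0 < b) (l n : ℕ) (A B : Finset ℕ)
    (hA : A ⊆ Finset.range (n + 1)) (hAB : excess A B (n + 1) = 1) :
    ∑ t : Fin n → Bool × Bool with Covers A B (n + 1) t, columnWeight a b l t =
      if ∀ j ≤ n, excess A B j = 0 ∨ excess A B j = 1 then
        (∏ j ∈ Finset.range n, chess a b (l + j)) * ∏ j ∈ A, siteFactor a b l A B j else 0 := by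
  -- Only height n is left out of `Covers A B n`; its two conditions become the prescribed values of
  -- p and q.
  have hT : ∑ t : Fin n → Bool × Bool with Covers A B (n + 1) t, columnWeight a b l t =
      columnSum a b l A B n (if n ∈ A then 1 else 0) (if n ∈ B then 0 else 1) := by
    rw [columnSum, Finset.sum_filter]
    refine Finset.sum_congr rfl fun t _ => if_congr ?_ rfl rfl
    unfold Covers
    constructor
    · exact fun h => ⟨fun k hk => h k (by omega), h n (by omega)⟩
    · rintro ⟨h1, h2⟩ k hk
      rcases Nat.lt_succ_iff_lt_or_eq.1 hk with hk | rfl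
      · exact h1 k hk
      · exact h2
  have hprod : (∏ j ∈ Finset.range n, chess a b (l + j)) * ∏ j ∈ A, siteFactor a b l A B j =
      columnProd a b l A B n * siteFactor a b l A B n := by
    rw [columnProd, Finset.prod_mul_distrib, mul_assoc, ← Finset.prod_range_succ,
      Finset.prod_subset hA]
    intro j _ hj
    rw [siteFactor, if_neg hj]
  rw [hT, hprod, columnSum_eq ha hb, siteFactor, ← chess_mul_succ a b (l + n)]
  rw [excess_succ] at hAB
  have hx := chess_pos ha hb (l + n)
  have hy := chess_pos ha hb (l + n + 1)
  by_cases hok : ∀ j ≤ n, excess A B j = 0 ∨ excess A B j = 1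
  · rw [if_pos hok, if_pos hok]
    have hn := hok n le_rfl
    by_cases h1 : n ∈ A <;> by_cases h2 : n ∈ B <;> simp only [h1, h2, if_true, if_false] at hAB ⊢
    · have : excess A B n = 1 := by omega
      simp only [this]
      norm_num
      field_simp
      simp
    · omega
    · have : excess A B n = 0 := by omega
      simp [this]
    · have : excess A B n = 1 := by omega
      simp [this]
  · rw [if_neg hok, if_neg hok]

/-! ### Configurations as families of column matchings -/

theorem bool_toNat_inj {r s : Bool} : r.toNat = s.toNat ↔ r = s := by
  cases r <;> cases s <;> simp

theorem Vertex.ext' {n : ℕ} {p q : Vertex n} (hX : p.X = q.X) (hY : p.Y = q.Y) : p = q :=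
  Subtype.ext (Prod.ext (Fin.ext hX) (Fin.ext hY))

theorem Vertex.X_le {n : ℕ} (p : Vertex n) : p.X ≤ 2 * n := Nat.lt_succ_iff.1 p.1.1.2

theorem Vertex.Y_le {n : ℕ} (p : Vertex n) : p.Y ≤ 2 * n := Nat.lt_succ_iff.1 p.1.2.2

theorem Vertex.odd_add {n : ℕ} (p : Vertex n) : (p.X + p.Y) % 2 = 1 := Nat.odd_iff.1 p.2

theorem exists_vertex {n x y : ℕ} (hx : x ≤ 2 * n) (hy : y ≤ 2 * n) (h : (x + y) % 2 = 1) :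
    ∃ p : Vertex n, p.X = x ∧ p.Y = y :=
  ⟨⟨(⟨x, by omega⟩, ⟨y, by omega⟩), Nat.odd_iff.2 h⟩, rfl, rfl⟩

/-- The vertices of the columns with even index. -/
def evenVertex {n : ℕ} (l : Fin (n + 1)) (k : Fin n) : Vertex n :=
  ⟨(⟨2 * l, by omega⟩, ⟨2 * k + 1, by omega⟩), Nat.odd_iff.2 (by simp only; omega)⟩

@[simp] theorem evenVertex_X {n : ℕ} (l : Fin (n + 1)) (k : Fin n) :
    (evenVertex l k).X = 2 * l := rfl

@[simp] theorem evenVertex_Y {n : ℕ} (l : Fin (n + 1)) (k : Fin n) :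
    (evenVertex l k).Y = 2 * k + 1 := rfl

theorem evenVertex_inj {n : ℕ} {l l' : Fin (n + 1)} {k k' : Fin n}
    (h : evenVertex l k = evenVertex l' k') : l = l' ∧ k = k' := by
  have hX := congrArg Vertex.X h
  have hY := congrArg Vertex.Y h
  simp only [evenVertex_X, evenVertex_Y] at hX hY
  exact ⟨Fin.ext (by omega), Fin.ext (by omega)⟩

theorem exists_evenVertex {n : ℕ} (p : Vertex n) (h : p.X % 2 = 0) :
    ∃ l k, p = evenVertex l k := by
  have h1 := p.X_le
  have h2 := p.Y_le
  have h3 := p.odd_add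
  refine ⟨⟨p.X / 2, by omega⟩, ⟨p.Y / 2, by omega⟩, Vertex.ext' ?_ ?_⟩
  · simp only [evenVertex_X]; omega
  · simp only [evenVertex_Y]; omega

theorem Config.exists_partner {n : ℕ} (c : Config n) (p : Vertex n) :
    ∃ q, c.1.Adj p q ∧ ∀ q', c.1.Adj p q' → q' = q := by
  obtain ⟨q, h1, h2⟩ := c.2.1 (c.2.2 p)
  exact ⟨q, h1, h2⟩

/-- `t l k` describes the vertex matched with `evenVertex l k` in the configuration `c`: the first
component tells whether it is on the right, the second one whether it is above. -/
def Codes {n : ℕ} (c : Config n) (t : Fin (n + 1) → Fin n → Bool × Bool) : Prop :=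
  ∀ l k q, c.1.Adj (evenVertex l k) q ↔
    q.X + 1 = 2 * (l + (t l k).1.toNat) ∧ q.Y = 2 * (k + (t l k).2.toNat)

theorem exists_codes {n : ℕ} (c : Config n) : ∃ t, Codes c t := by
  have h : ∀ l : Fin (n + 1), ∀ k : Fin n, ∃ ru : Bool × Bool, ∀ q, c.1.Adj (evenVertex l k) q ↔
      q.X + 1 = 2 * (l + ru.1.toNat) ∧ q.Y = 2 * (k + ru.2.toNat) := by
    intro l k
    obtain ⟨w, hw, huniq⟩ := c.exists_partner (evenVertex l k)
    have hadj : ((2 * (l : ℕ) = w.X + 1 ∨ w.X = 2 * (l : ℕ) + 1) ∧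
        (2 * (k : ℕ) + 1 = w.Y + 1 ∨ w.Y = 2 * (k : ℕ) + 1 + 1)) := c.1.adj_sub hw
    have hru : ∃ ru : Bool × Bool, w.X + 1 = 2 * (l + ru.1.toNat) ∧
        w.Y = 2 * (k + ru.2.toNat) := by
      rcases hadj with ⟨h1 | h1, h2 | h2⟩
      · exact ⟨(false, false), by simp; omega⟩
      · exact ⟨(false, true), by simp; omega⟩
      · exact ⟨(true, false), by simp; omega⟩
      · exact ⟨(true, true), by simp; omega⟩
    obtain ⟨ru, h1, h2⟩ := hru
    refine ⟨ru, fun q => ⟨fun hq => ?_, fun hq => ?_⟩⟩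
    · rw [huniq q hq]; exact ⟨h1, h2⟩
    · have : q = w := Vertex.ext' (by omega) (by omega)
      rwa [this]
  choose t ht using h
  exact ⟨t, ht⟩

namespace Codes

variable {n : ℕ} {c : Config n} {t : Fin (n + 1) → Fin n → Bool × Bool}

theorem bounds (h : Codes c t) (l : Fin (n + 1)) (k : Fin n) :
    1 ≤ (l : ℕ) + (t l k).1.toNat ∧ (l : ℕ) + (t l k).1.toNat ≤ n := by
  obtain ⟨q, hq, -⟩ := c.exists_partner (evenVertex l k)
  have := (h l k q).1 hq
  have := q.X_le
  omega

theorem code_unique {t' : Fin (n + 1) → Fin n → Bool × Bool} (h : Codes c t) (h' : Codes c t') :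
    t = t' := by
  funext l k
  obtain ⟨q, hq, -⟩ := c.exists_partner (evenVertex l k)
  have h1 := (h l k q).1 hq
  have h2 := (h' l k q).1 hq
  refine Prod.ext ?_ ?_
  · apply bool_toNat_inj.1; omega
  · apply bool_toNat_inj.1; omega

theorem config_unique {c' : Config n} (h : Codes c t) (h' : Codes c' t) : c = c' := by
  have key : ∀ p q : Vertex n, p.X % 2 = 0 → (c.1.Adj p q ↔ c'.1.Adj p q) := by
    intro p q hp
    obtain ⟨l, k, rfl⟩ := exists_evenVertex p hp
    rw [h l k q, h' l k q]
  have hodd : ∀ (d : Config n) (p q : Vertex n), d.1.Adj p q → p.X % 2 ≠ 0 → q.X % 2 = 0 := by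
    intro d p q hpq hp
    have := (d.1.adj_sub hpq).1
    omega
  refine Subtype.ext (SimpleGraph.Subgraph.ext ?_ ?_)
  · ext p; exact ⟨fun _ => c'.2.2 p, fun _ => c.2.2 p⟩
  · funext p q
    refine propext ?_
    by_cases hp : p.X % 2 = 0
    · exact key p q hp
    · constructor
      · intro hpq
        exact ((key q p (hodd c p q hpq hp)).1 hpq.symm).symm
      · intro hpq
        exact ((key q p (hodd c' p q hpq hp)).2 hpq.symm).symm

/-- A dimer at the face (i, j) leaves column i + 1 to the left or column i to the right, from the
vertex of index j; both cases read l + r = i + 1, and going up or down is irrelevant. -/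
theorem numDimers_eq (h : Codes c t) (i j : Fin n) :
    numDimers c i j = (Finset.univ.filter fun l : Fin (n + 1) =>
      (l : ℕ) + (t l j).1.toNat = i + 1).card := by
  choose q hq _ using fun l => c.exists_partner (evenVertex l j)
  have hS : {e : Sym2 (Vertex n) | e ∈ c.1.edgeSet ∧ ∀ p ∈ e, IsCorner i j p} =
      (fun l => s(evenVertex l j, q l)) '' {l | (l : ℕ) + (t l j).1.toNat = i + 1} := by
    have key : ∀ p p' : Vertex n, p.X % 2 = 0 → c.1.Adj p p' → IsCorner i j p → IsCorner i j p' →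
        ∃ l : Fin (n + 1), (l : ℕ) + (t l j).1.toNat = i + 1 ∧
          s(evenVertex l j, q l) = s(p, p') := by
      intro p p' hp hadj hc hc'
      obtain ⟨l, k, rfl⟩ := exists_evenVertex p hp
      have h1 := (h l k p').1 hadj
      unfold IsCorner at hc hc'
      simp only [evenVertex_X, evenVertex_Y] at hc
      have hk : k = j := Fin.ext (by omega)
      subst hk
      refine ⟨l, by omega, ?_⟩
      have h2 := (h l k (q l)).1 (hq l)
      have : q l = p' := Vertex.ext' (by omega) (by omega)
      rw [this]
    ext e
    induction e with
    | _ p p' =>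
    simp only [Set.mem_ofPred_eq, SimpleGraph.Subgraph.mem_edgeSet, Sym2.mem_iff, forall_eq_or_imp,
      forall_eq, Set.mem_image]
    constructor
    · rintro ⟨hadj, hc, hc'⟩
      by_cases hp : p.X % 2 = 0
      · exact key p p' hp hadj hc hc'
      · have hp' : p'.X % 2 = 0 := by
          have := (c.1.adj_sub hadj).1
          omega
        obtain ⟨l, h1, h2⟩ := key p' p hp' hadj.symm hc' hc
        exact ⟨l, h1, h2.trans Sym2.eq_swap⟩
    · rintro ⟨l, hl, he⟩
      have hl : (l : ℕ) + (t l j).1.toNat = i + 1 := hl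
      have h2 := (h l j (q l)).1 (hq l)
      have hr := Bool.toNat_le (t l j).1
      have hu := Bool.toNat_le (t l j).2
      have hc1 : IsCorner i j (evenVertex l j) := by
        refine Or.inr ⟨rfl, ?_⟩
        simp only [evenVertex_X]
        omega
      have hc2 : IsCorner i j (q l) := by
        unfold IsCorner
        omega
      rcases Sym2.eq_iff.1 he with ⟨rfl, rfl⟩ | ⟨rfl, rfl⟩
      · exact ⟨hq l, hc1, hc2⟩
      · exact ⟨(hq l).symm, hc2, hc1⟩
  rw [numDimers, hS, Set.InjOn.ncard_image, Set.ncard_eq_toFinset_card']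
  · congr 1
    ext l
    simp
  · intro l _ l' _ he
    rcases Sym2.eq_iff.1 he with ⟨h1, -⟩ | ⟨h1, -⟩
    · exact (evenVertex_inj h1).1
    · have h2 := (h l' j (q l')).1 (hq l')
      rw [← h1] at h2
      simp only [evenVertex_X] at h2
      omega

theorem weight_eq (h : Codes c t) (a b : ℝ) :
    weight a b c = ∏ l : Fin (n + 1), columnWeight a b l (t l) := by
  unfold weight columnWeight
  rw [Finset.prod_comm, Finset.prod_comm (s := Finset.univ (α := Fin (n + 1)))]
  refine Finset.prod_congr rfl fun j _ => ?_
  let g : Fin (n + 1) → Fin n := fun l => ⟨(l : ℕ) + (t l j).1.toNat - 1, by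
    have := h.bounds l j; omega⟩
  rw [← Finset.prod_fiberwise_of_maps_to (g := g) (t := Finset.univ) (fun _ _ => Finset.mem_univ _)]
  refine Finset.prod_congr rfl fun i _ => ?_
  rw [h.numDimers_eq, ← Finset.prod_const]
  have hg : ∀ l, g l = i ↔ (l : ℕ) + (t l j).1.toNat = i + 1 := by
    intro l
    have := h.bounds l j
    rw [Fin.ext_iff]
    simp only [g]
    omega
  simp only [hg]
  refine Finset.prod_congr rfl fun l hl => ?_
  have hl' := (Finset.mem_filter.1 hl).2
  unfold faceWeight chess
  refine if_congr ?_ rfl rfl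
  -- The index in `columnWeight` is that of the face shifted by 2, which keeps the parity and avoids
  -- a subtraction at l = 0.
  rw [show (l : ℕ) + j + (t l j).1.toNat + 1 = i + j + 2 by omega]
  simp [Nat.even_add]

end Codes

theorem hits_eq_ite {N : ℕ} (t : Fin N → Bool × Bool) (s : Bool) (h : ℕ) (P : Fin N → Prop)
    (hP : ∀ k, (t k).1 = s ∧ (k : ℕ) + (t k).2.toNat = h ↔ P k)
    (huniq : ∀ k k', P k → P k' → k = k') (Q : Prop) [Decidable Q] (hQ : Q ↔ ∃ k, P k) :
    hits t s h = if Q then 1 else 0 := by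
  split_ifs with hq
  · obtain ⟨k, hk⟩ := hQ.1 hq
    rw [hits, Finset.sum_eq_single k, if_pos ((hP k).2 hk)]
    · intro k' _ hk'
      exact if_neg fun h' => hk' (huniq _ _ ((hP k').1 h') hk)
    · simp
  · refine Finset.sum_eq_zero fun k _ => if_neg fun h' => hq (hQ.2 ⟨k, (hP k).1 h'⟩)

theorem exists_of_hits_ne_zero {N : ℕ} {t : Fin N → Bool × Bool} {s : Bool} {h : ℕ}
    (hh : hits t s h ≠ 0) : ∃ k, (t k).1 = s ∧ (k : ℕ) + (t k).2.toNat = h := by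
  obtain ⟨k, -, hk⟩ := Finset.exists_ne_zero_of_sum_ne_zero hh
  exact ⟨k, by by_contra h'; exact hk (if_neg h')⟩

theorem hits_pos {N : ℕ} {t : Fin N → Bool × Bool} {s : Bool} {h : ℕ} {k : Fin N}
    (hk : (t k).1 = s ∧ (k : ℕ) + (t k).2.toNat = h) : hits t s h ≠ 0 := by
  intro h0
  have := (Finset.sum_eq_zero_iff.1 h0) k (Finset.mem_univ _)
  rw [if_pos hk] at this
  exact one_ne_zero this

theorem eq_of_hits_eq_one {N : ℕ} {t : Fin N → Bool × Bool} {s : Bool} {h : ℕ}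
    (hh : hits t s h = 1) {k k' : Fin N} (hk : (t k).1 = s ∧ (k : ℕ) + (t k).2.toNat = h)
    (hk' : (t k').1 = s ∧ (k' : ℕ) + (t k').2.toNat = h) : k = k' := by
  rw [hits, Finset.sum_boole] at hh
  simp only [Nat.cast_id] at hh
  exact Finset.card_le_one.1 hh.le _ (by simpa using hk) _ (by simpa using hk')

theorem mem_particles {n : ℕ} (c : Config n) (l : Fin (n + 1)) (q : Vertex n) (h : ℕ)
    (hX : q.X + 1 = 2 * (l : ℕ)) (hY : q.Y = 2 * h) :
    h ∈ particles c l ↔ ∃ k, c.1.Adj (evenVertex l k) q := by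
  unfold particles
  rw [if_neg (by omega)]
  constructor
  · rintro ⟨p, p', h1, h2, h3, h4⟩
    obtain ⟨l', k, rfl⟩ := exists_evenVertex p' (by omega)
    have hp : p = q := Vertex.ext' (by omega) (by omega)
    subst hp
    simp only [evenVertex_X] at h3
    have hl : l' = l := Fin.ext (by omega)
    subst hl
    exact ⟨k, h4.symm⟩
  · rintro ⟨k, hk⟩
    exact ⟨q, evenVertex l k, hX, hY, rfl, hk.symm⟩

theorem particles_subset {n : ℕ} (c : Config n) (l h : ℕ) (hh : h ∈ particles c l) : h ≤ n := by
  unfold particles at hh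
  split_ifs at hh
  · exact hh
  · obtain ⟨p, _, _, hp, _⟩ := hh
    have := p.Y_le
    omega

theorem particles_zero {n : ℕ} (c : Config n) : particles c 0 = ∅ := by
  unfold particles
  rw [if_neg (by omega)]
  ext k
  simp

open Classical in
/-- The particles of a configuration on level `l`, as a finite set. -/
noncomputable def level {n : ℕ} (c : Config n) (l : ℕ) : Finset ℕ :=
  (Finset.range (n + 1)).filter (· ∈ particles c l)

theorem mem_level {n : ℕ} (c : Config n) (l h : ℕ) : h ∈ level c l ↔ h ∈ particles c l := by
  classical
  unfold level
  rw [Finset.mem_filter, Finset.mem_range]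
  exact ⟨fun h => h.2, fun h => ⟨Nat.lt_succ_of_le (particles_subset c _ _ h), h⟩⟩

theorem Codes.covers {n : ℕ} {c : Config n} {t : Fin (n + 1) → Fin n → Bool × Bool}
    (ht : Codes c t) (l : Fin (n + 1)) : Covers (level c l) (level c (l + 1)) (n + 1) (t l) := by
  intro h hh
  have hP : ∀ (s : Bool) (q : Vertex n), q.X + 1 = 2 * ((l : ℕ) + s.toNat) → q.Y = 2 * h →
      ∀ k, (t l k).1 = s ∧ (k : ℕ) + (t l k).2.toNat = h ↔ c.1.Adj (evenVertex l k) q := by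
    intro s q hX hY k
    rw [ht l k q, ← bool_toNat_inj]
    omega
  have huniq : ∀ q : Vertex n, ∀ k k', c.1.Adj (evenVertex l k) q → c.1.Adj (evenVertex l k') q →
      k = k' := by
    intro q k k' h1 h2
    obtain ⟨w, -, hw⟩ := c.exists_partner q
    exact (evenVertex_inj ((hw _ h1.symm).trans (hw _ h2.symm).symm)).2
  constructor
  -- The outer columns l = 0 and l = n have no neighbours on one side, in agreement with level 0
  -- being empty and level n + 1 being full.
  · rcases Nat.eq_zero_or_pos (l : ℕ) with h0 | h0
    · rw [if_neg (by rw [mem_level, h0, particles_zero]; simp)]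
      by_contra hne
      obtain ⟨k, hk, -⟩ := exists_of_hits_ne_zero hne
      have := ht.bounds l k
      rw [hk, h0] at this
      simp at this
    · obtain ⟨q, hX, hY⟩ := exists_vertex (n := n) (x := 2 * l - 1) (y := 2 * h) (by omega)
        (by omega) (by omega)
      refine hits_eq_ite _ _ _ _ (hP false q (by simp; omega) hY) (huniq q) _ ?_
      rw [mem_level]
      exact mem_particles c l q h (by omega) hY
  · rcases Nat.lt_or_ge (l : ℕ) n with h0 | h0
    · obtain ⟨q, hX, hY⟩ := exists_vertex (n := n) (x := 2 * l + 1) (y := 2 * h) (by omega)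
        (by omega) (by omega)
      rw [← ite_not]
      refine hits_eq_ite _ _ _ _ (hP true q (by simp; omega) hY) (huniq q) _ ?_
      rw [mem_level, show (l : ℕ) + 1 = ((⟨l + 1, by omega⟩ : Fin (n + 1)) : ℕ) from rfl,
        mem_particles c _ q h (by simp only; omega) hY]
      obtain ⟨w, hw, hwu⟩ := c.exists_partner q
      have hadj := (c.1.adj_sub hw).1
      obtain ⟨l', k', rfl⟩ := exists_evenVertex w (by omega)
      simp only [evenVertex_X] at hadj
      constructor
      · intro hne
        rcases hadj with h1 | h1
        · have : l' = l := Fin.ext (by omega)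
          subst this
          exact ⟨k', hw.symm⟩
        · have : l' = ⟨l + 1, by omega⟩ := Fin.ext (by simp only; omega)
          exact absurd ⟨k', this ▸ hw.symm⟩ hne
      · rintro ⟨k, hk⟩ ⟨k2, hk2⟩
        have := (evenVertex_inj ((hwu _ hk.symm).trans (hwu _ hk2.symm).symm)).1
        rw [Fin.ext_iff] at this
        simp only at this
        omega
    · have hl : (l : ℕ) = n := by omega
      rw [if_pos (by
        rw [mem_level, hl]; unfold particles; rw [if_pos rfl]; exact Nat.lt_succ_iff.1 hh)]
      by_contra hne
      obtain ⟨k, hk, -⟩ := exists_of_hits_ne_zero hne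
      have := ht.bounds l k
      rw [hk, hl] at this
      simp at this

theorem level_of_covers {n : ℕ} {c : Config n} {t : Fin (n + 1) → Fin n → Bool × Bool}
    (ht : Codes c t) {A : ℕ → Finset ℕ} (hA : ∀ l, l ≤ n + 1 → A l ⊆ Finset.range (n + 1))
    (hfull : A (n + 1) = Finset.range (n + 1))
    (hcov : ∀ l : Fin (n + 1), Covers (A l) (A (l + 1)) (n + 1) (t l)) (l : ℕ) (hl : l ≤ n + 1) :
    (A l : Set ℕ) = particles c l := by
  ext h
  rw [Finset.mem_coe, ← mem_level]
  have hlev : ∀ h, h ∈ level c l → h < n + 1 := fun h hh =>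
    Nat.lt_succ_of_le (particles_subset c l h ((mem_level c l h).1 hh))
  by_cases hh : h < n + 1
  · rcases Nat.lt_succ_iff_lt_or_eq.1 (Nat.lt_succ_of_le hl) with h1 | h1
    · have e1 := (hcov ⟨l, h1⟩ h hh).1
      have e2 := (ht.covers ⟨l, h1⟩ h hh).1
      rw [e1] at e2
      simp only at e2
      by_cases m1 : h ∈ A l <;> by_cases m2 : h ∈ level c l <;> simp [m1, m2] at e2 ⊢
    · subst h1
      rw [hfull, mem_level]
      unfold particles
      rw [if_pos rfl, Finset.mem_range]
      exact Nat.lt_succ_iff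
  · exact ⟨fun h' => absurd (Finset.mem_range.1 (hA l hl h')) hh, fun h' => absurd (hlev h h') hh⟩

/-- A vertex of even abscissa is matched by its code. A vertex of odd abscissa lies between two
columns: if it is a particle it is hit once from the right column and never from the left one, and
if it is a hole the roles are exchanged. -/
theorem exists_config_of_covers {n : ℕ} {t : Fin (n + 1) → Fin n → Bool × Bool}
    {A : ℕ → Finset ℕ} (h0 : A 0 = ∅) (hfull : A (n + 1) = Finset.range (n + 1))
    (hcov : ∀ l : Fin (n + 1), Covers (A l) (A (l + 1)) (n + 1) (t l)) :
    ∃ c : Config n, Codes c t := by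
  let R : Vertex n → Vertex n → Prop := fun p q => ∃ l k, p = evenVertex l k ∧
    q.X + 1 = 2 * (l + (t l k).1.toNat) ∧ q.Y = 2 * (k + (t l k).2.toNat)
  have hR : ∀ p q, R p q → p.X % 2 = 0 ∧ q.X % 2 = 1 ∧ (graph n).Adj p q := by
    rintro p q ⟨l, k, rfl, h1, h2⟩
    have hr := Bool.toNat_le (t l k).1
    have hu := Bool.toNat_le (t l k).2
    refine ⟨by simp, by omega, ?_, ?_⟩
    · simp only [evenVertex_X]; omega
    · simp only [evenVertex_Y]; omega
  let M : (graph n).Subgraph :=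
    { verts := Set.univ
      Adj := fun p q => R p q ∨ R q p
      adj_sub := by
        rintro p q (h | h)
        · exact (hR p q h).2.2
        · exact (hR q p h).2.2.symm
      edge_vert := fun _ => Set.mem_univ _
      symm := ⟨fun p q h => h.symm⟩ }
  have hRe : ∀ l k q, R (evenVertex l k) q ↔
      q.X + 1 = 2 * (l + (t l k).1.toNat) ∧ q.Y = 2 * (k + (t l k).2.toNat) := by
    intro l k q
    constructor
    · rintro ⟨l', k', he, h⟩
      obtain ⟨rfl, rfl⟩ := evenVertex_inj he
      exact h
    · exact fun h => ⟨l, k, rfl, h⟩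
  have hMe : ∀ l k q, M.Adj (evenVertex l k) q ↔ R (evenVertex l k) q := by
    intro l k q
    constructor
    · rintro (h | h)
      · exact h
      · have := (hR _ _ h).2.1
        simp at this
    · exact Or.inl
  have hM : M.IsPerfectMatching := by
    refine ⟨fun p _ => ?_, fun p => Set.mem_univ p⟩
    by_cases hp : p.X % 2 = 0
    · obtain ⟨l, k, rfl⟩ := exists_evenVertex p hp
      have hu := Bool.toNat_le (t l k).2
      have hne := hits_pos (t := t l) (k := k) ⟨rfl, rfl⟩
      -- No code points outside the graph: such a hit is excluded by the empty level 0 or by the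
      -- full level n + 1.
      have hb : 1 ≤ (l : ℕ) + (t l k).1.toNat ∧ (l : ℕ) + (t l k).1.toNat ≤ n := by
        cases hr : (t l k).1
        · refine ⟨Nat.pos_of_ne_zero fun hl => hne ?_, by simp; omega⟩
          have hl' : (l : ℕ) = 0 := by simpa using hl
          rw [hr, (hcov l _ (by omega)).1, hl', h0]
          simp
        · refine ⟨by simp, ?_⟩
          by_contra hl
          refine hne ?_
          have hl' : (l : ℕ) = n := by simp at hl; omega
          rw [hr, (hcov l _ (by omega)).2, hl', hfull, if_pos]
          rw [Finset.mem_range]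
          omega
      obtain ⟨q, hX, hY⟩ := exists_vertex (n := n) (x := 2 * (l + (t l k).1.toNat) - 1)
        (y := 2 * (k + (t l k).2.toNat)) (by omega) (by omega) (by omega)
      refine ⟨q, (hMe l k q).2 ((hRe l k q).2 ⟨by omega, hY⟩), fun q' hq' => ?_⟩
      have := (hRe l k q').1 ((hMe l k q').1 hq')
      clear hq'
      exact Vertex.ext' (by omega) (by omega)
    · have hp1 := p.X_le
      have hp2 := p.Y_le
      have hp3 := p.odd_add
      obtain ⟨L, hL⟩ : ∃ L, p.X = 2 * L + 1 := ⟨p.X / 2, by omega⟩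
      obtain ⟨h, hh⟩ : ∃ h, p.Y = 2 * h := ⟨p.Y / 2, by omega⟩
      have c1 := (hcov ⟨L + 1, by omega⟩ h (by omega)).1
      have c2 := (hcov ⟨L, by omega⟩ h (by omega)).2
      simp only at c1 c2
      have hadj : ∀ q, M.Adj p q → ∃ l k, q = evenVertex l k ∧
          (((l = (⟨L + 1, by omega⟩ : Fin (n + 1)) ∧ (t l k).1 = false) ∨
            (l = (⟨L, by omega⟩ : Fin (n + 1)) ∧ (t l k).1 = true)) ∧
            (k : ℕ) + (t l k).2.toNat = h) := by
        rintro q (hq | hq)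
        · exact absurd (hR _ _ hq).1 hp
        · obtain ⟨l, k, rfl, e1, e2⟩ := hq
          refine ⟨l, k, rfl, ?_, by omega⟩
          cases hr : (t l k).1
          · rw [hr] at e1
            simp at e1
            exact Or.inl ⟨Fin.ext (by simp only; omega), rfl⟩
          · rw [hr] at e1
            simp at e1
            exact Or.inr ⟨Fin.ext (by simp only; omega), rfl⟩
      by_cases hmem : h ∈ A (L + 1)
      · rw [if_pos hmem] at c1 c2
        obtain ⟨k, hk1, hk2⟩ := exists_of_hits_ne_zero (c1.trans_ne one_ne_zero)
        refine ⟨evenVertex ⟨L + 1, by omega⟩ k, Or.inr ((hRe _ _ _).2 ?_), fun q hq => ?_⟩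
        · rw [hk1]; simp; omega
        · obtain ⟨l', k', rfl, ⟨rfl, e1⟩ | ⟨rfl, e1⟩, e2⟩ := hadj q hq
          · rw [eq_of_hits_eq_one c1 ⟨e1, e2⟩ ⟨hk1, hk2⟩]
          · exact absurd c2 (hits_pos ⟨e1, e2⟩)
      · rw [if_neg hmem] at c1 c2
        obtain ⟨k, hk1, hk2⟩ := exists_of_hits_ne_zero (c2.trans_ne one_ne_zero)
        refine ⟨evenVertex ⟨L, by omega⟩ k, Or.inr ((hRe _ _ _).2 ?_), fun q hq => ?_⟩
        · rw [hk1]; simp; omega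
        · obtain ⟨l', k', rfl, ⟨rfl, e1⟩ | ⟨rfl, e1⟩, e2⟩ := hadj q hq
          · exact absurd c1 (hits_pos ⟨e1, e2⟩)
          · rw [eq_of_hits_eq_one c2 ⟨e1, e2⟩ ⟨hk1, hk2⟩]
  exact ⟨⟨M, hM⟩, fun l k q => (hMe l k q).trans (hRe l k q)⟩

theorem sum_hits {N : ℕ} (t : Fin N → Bool × Bool) :
    ∑ h ∈ Finset.range (N + 1), (hits t false h + hits t true h) = N := by
  have h1 : ∀ k : Fin N, ∑ h ∈ Finset.range (N + 1),
      ((if (t k).1 = false ∧ (k : ℕ) + (t k).2.toNat = h then 1 else 0) +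
        if (t k).1 = true ∧ (k : ℕ) + (t k).2.toNat = h then 1 else 0) = 1 := by
    intro k
    have hk := Bool.toNat_le (t k).2
    have hmem : (k : ℕ) + (t k).2.toNat ∈ Finset.range (N + 1) := by
      rw [Finset.mem_range]; omega
    rw [Finset.sum_eq_single_of_mem _ hmem]
    · cases (t k).1 <;> simp
    · intro h _ hne
      rw [if_neg (fun e => hne e.2.symm), if_neg (fun e => hne e.2.symm), add_zero]
  simp only [hits, ← Finset.sum_add_distrib]
  rw [Finset.sum_comm, Finset.sum_congr rfl fun k _ => h1 k]
  simp

/-- The n vertices of the column are matched with the points of A and the n + 1 - |B| holes of B. -/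
theorem card_of_covers {n : ℕ} {A B : Finset ℕ} {t : Fin n → Bool × Bool}
    (hA : A ⊆ Finset.range (n + 1)) (hB : B ⊆ Finset.range (n + 1))
    (h : Covers A B (n + 1) t) : B.card = A.card + 1 := by
  have h1 := sum_hits t
  rw [Finset.sum_congr rfl fun k hk => by
    rw [(h k (Finset.mem_range.1 hk)).1, (h k (Finset.mem_range.1 hk)).2],
    Finset.sum_add_distrib] at h1
  have e1 : ∑ k ∈ Finset.range (n + 1), (if k ∈ A then 1 else 0) = A.card := by
    rw [Finset.sum_ite_mem, Finset.inter_eq_right.2 hA]; simp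
  have e2 : ∑ k ∈ Finset.range (n + 1), (if k ∈ B then 0 else 1) + B.card = n + 1 := by
    have : B.card = ∑ k ∈ Finset.range (n + 1), (if k ∈ B then 1 else 0) := by
      rw [Finset.sum_ite_mem, Finset.inter_eq_right.2 hB]; simp
    rw [this, ← Finset.sum_add_distrib, Finset.sum_congr rfl (g := fun _ => 1)]
    · simp
    · intro k _; split_ifs <;> rfl
  omega

theorem level_subset {n : ℕ} (c : Config n) (l : ℕ) : level c l ⊆ Finset.range (n + 1) := by
  intro h hh
  rw [Finset.mem_range]
  exact Nat.lt_succ_of_le (particles_subset c l h ((mem_level c l h).1 hh))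

theorem card_level {n : ℕ} (c : Config n) (l : ℕ) (hl : l ≤ n + 1) : (level c l).card = l := by
  obtain ⟨t, ht⟩ := exists_codes c
  induction l with
  | zero =>
    rw [Finset.card_eq_zero, Finset.eq_empty_iff_forall_notMem]
    intro h hh
    rw [mem_level, particles_zero] at hh
    exact hh
  | succ l ih =>
    rw [card_of_covers (level_subset c l) (level_subset c (l + 1)) (ht.covers ⟨l, by omega⟩),
      ih (by omega)]

/-- The sum over the configurations with given particles factorizes into column sums. -/
theorem sum_weight_eq_prod {n : ℕ} (a b : ℝ) {A : ℕ → Finset ℕ} (h0 : A 0 = ∅)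
    (hfull : A (n + 1) = Finset.range (n + 1))
    (hA : ∀ l, l ≤ n + 1 → A l ⊆ Finset.range (n + 1)) (s : Finset (Config n))
    (hs : ∀ c, c ∈ s ↔ ∀ l ≤ n + 1, (A l : Set ℕ) = particles c l) :
    ∑ c ∈ s, weight a b c = ∏ l : Fin (n + 1),
      ∑ t : Fin n → Bool × Bool with Covers (A l) (A (l + 1)) (n + 1) t, columnWeight a b l t := by
  rw [Finset.prod_univ_sum]
  choose code hcode using exists_codes (n := n)
  have hlev : ∀ c, c ∈ s → ∀ l ≤ n + 1, level c l = A l := by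
    intro c hc l hl
    ext h
    rw [mem_level, ← (hs c).1 hc l hl, Finset.mem_coe]
  refine Finset.sum_bij (fun c _ => code c) ?_ ?_ ?_ ?_
  · intro c hc
    rw [Fintype.mem_piFinset]
    intro l
    have := (hcode c).covers l
    rw [hlev c hc l (by omega), hlev c hc (l + 1) (by omega)] at this
    simpa using this
  · intro c _ c' _ he
    exact (hcode c).config_unique (he ▸ hcode c')
  · intro t ht
    have hcov : ∀ l : Fin (n + 1), Covers (A l) (A (l + 1)) (n + 1) (t l) := fun l => by
      simpa using Fintype.mem_piFinset.1 ht l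
    obtain ⟨c, hc⟩ := exists_config_of_covers h0 hfull hcov
    exact ⟨c, (hs c).2 fun l hl => level_of_covers hc hA hfull hcov l hl,
      (hcode c).code_unique hc⟩
  · intro c _
    exact (hcode c).weight_eq a b

/-! ### Interlacing and the weight when all levels are prescribed -/

theorem prod_chess (a b : ℝ) (n : ℕ) :
    ∏ l ∈ Finset.range (n + 1), ∏ j ∈ Finset.range n, chess a b (l + j) =
      (a * b) ^ ∑ l ∈ Finset.range (n + 1), l := by
  induction n with
  | zero => simp
  | succ n ih =>
    rw [Finset.prod_range_succ]
    have h1 : ∀ l, ∏ j ∈ Finset.range (n + 1), chess a b (l + j) =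
        (∏ j ∈ Finset.range n, chess a b (l + j)) * chess a b (l + n) := fun l =>
      Finset.prod_range_succ _ _
    rw [Finset.prod_congr rfl fun l _ => h1 l, Finset.prod_mul_distrib, ih,
      Finset.sum_range_succ _ (n + 1), pow_add, mul_assoc, ← Finset.prod_mul_distrib]
    -- The new row l = n + 1 and the new column j = n pair off: `chess a b (l + n)` with its
    -- successor, each pair contributing a b.
    congr 1
    rw [Finset.prod_congr rfl (g := fun _ => a * b), Finset.prod_const, Finset.card_range]
    intro l _
    rw [show n + 1 + l = l + n + 1 by ring, chess_mul_succ]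

/-- Translates between the ordered list of particles and its counting function. -/
theorem lt_card_filter_iff {l : ℕ} {x : Fin l → ℕ} (hx : StrictMono x) (i : Fin l) (j : ℕ) :
    (i : ℕ) < ((Finset.univ.image x).filter (· < j)).card ↔ x i < j := by
  rw [Finset.filter_image, Finset.card_image_of_injective _ hx.injective]
  constructor
  · intro h
    by_contra hj
    have hsub : Finset.univ.filter (fun k => x k < j) ⊆ Finset.Iio i := by
      intro k hk
      rw [Finset.mem_filter] at hk
      rw [Finset.mem_Iio]
      exact hx.lt_iff_lt.1 (by omega)
    have := Finset.card_le_card hsub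
    rw [Fin.card_Iio] at this
    omega
  · intro h
    have hsub : Finset.Iic i ⊆ Finset.univ.filter (fun k => x k < j) := by
      intro k hk
      rw [Finset.mem_Iic] at hk
      simp only [Finset.mem_filter, Finset.mem_univ, true_and]
      exact lt_of_le_of_lt (hx.monotone hk) h
    have := Finset.card_le_card hsub
    rw [Fin.card_Iic] at this
    omega

theorem card_filter_image_le {l : ℕ} (x : Fin l → ℕ) (j : ℕ) :
    ((Finset.univ.image x).filter (· < j)).card ≤ l :=
  (Finset.card_filter_le _ _).trans (Finset.card_image_le.trans (by simp))

/-- Interlacing says that below every height the longer list has as many entries as the shorter one,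
or one more. At height n + 1 this holds automatically, since the lists have l and l + 1 entries. -/
theorem interlaced_iff_excess {l n : ℕ} {x : Fin l → ℕ} {y : Fin (l + 1) → ℕ} (hx : StrictMono x)
    (hy : StrictMono y) (hxn : ∀ i, x i ≤ n) (hyn : ∀ i, y i ≤ n) :
    (∀ i, y i.castSucc ≤ x i ∧ x i ≤ y i.succ) ↔
      ∀ j ≤ n, excess (Finset.univ.image x) (Finset.univ.image y) j = 0 ∨
        excess (Finset.univ.image x) (Finset.univ.image y) j = 1 := by
  have hxl := card_filter_image_le x
  have hyl := card_filter_image_le y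
  have hX := lt_card_filter_iff hx
  have hY := lt_card_filter_iff hy
  unfold excess
  constructor
  · intro h j _
    have e1 := hxl j
    have e2 := hyl j
    have h1 : ((Finset.univ.image x).filter (· < j)).card ≤
        ((Finset.univ.image y).filter (· < j)).card := by
      by_contra hlt
      have hp : ((Finset.univ.image y).filter (· < j)).card < l := by omega
      have h2 := (hX ⟨_, hp⟩ j).1 (by simp only; omega)
      have h3 := (hY (Fin.castSucc ⟨_, hp⟩) j).2 (lt_of_le_of_lt (h ⟨_, hp⟩).1 h2)
      simp at h3
    have h2 : ((Finset.univ.image y).filter (· < j)).card ≤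
        ((Finset.univ.image x).filter (· < j)).card + 1 := by
      by_contra hlt
      have hp : ((Finset.univ.image x).filter (· < j)).card < l := by omega
      have h2 := (hY (Fin.succ ⟨_, hp⟩) j).1 (by simp only [Fin.val_succ]; omega)
      have h3 := (hX ⟨_, hp⟩ j).2 (lt_of_le_of_lt (h ⟨_, hp⟩).2 h2)
      simp at h3
    omega
  · intro h
    have h' : ∀ j ≤ n + 1, ((Finset.univ.image x).filter (· < j)).card ≤
        ((Finset.univ.image y).filter (· < j)).card ∧
        ((Finset.univ.image y).filter (· < j)).card ≤
          ((Finset.univ.image x).filter (· < j)).card + 1 := by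
      intro j hj
      rcases Nat.le_succ_iff.1 hj with hj | rfl
      · have := h j hj
        omega
      · have ex : (Finset.univ.image x).filter (· < n + 1) = Finset.univ.image x := by
          rw [Finset.filter_eq_self]
          intro k hk
          obtain ⟨i, -, rfl⟩ := Finset.mem_image.1 hk
          exact Nat.lt_succ_of_le (hxn i)
        have ey : (Finset.univ.image y).filter (· < n + 1) = Finset.univ.image y := by
          rw [Finset.filter_eq_self]
          intro k hk
          obtain ⟨i, -, rfl⟩ := Finset.mem_image.1 hk
          exact Nat.lt_succ_of_le (hyn i)
        rw [Nat.succ_eq_add_one, ex, ey, Finset.card_image_of_injective _ hx.injective,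
          Finset.card_image_of_injective _ hy.injective]
        simp
    intro i
    constructor
    · have h1 := (hX i (x i + 1)).2 (by omega)
      have h2 := h' (x i + 1) (by have := hxn i; omega)
      have h3 := (hY i.castSucc (x i + 1)).1 (by simp only [Fin.val_castSucc]; omega)
      omega
    · have h1 := (hY i.succ (y i.succ + 1)).2 (by omega)
      have h2 := h' (y i.succ + 1) (by have := hyn i.succ; omega)
      rw [Fin.val_succ] at h1
      have h3 := (hX i (y i.succ + 1)).1 (by omega)
      omega

/-- The factor of the particle `x l i` in `Omega`. -/
noncomputable def particleFactor (a b : ℝ) (x : Positions) (l : ℕ) (i : Fin l) : ℝ :=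
  (a ^ 2) ^ (infOdd x l i + supEven x l i) * (b ^ 2) ^ (infEven x l i + supOdd x l i) /
    (a ^ 2 + b ^ 2) ^ adjacency x l i

theorem Omega_eq_prod (a b : ℝ) (m n : ℕ) (x : Positions) :
    Omega a b m n x = ∏ l ∈ Finset.Icc m n, ∏ i : Fin l, particleFactor a b x l i := by
  unfold Omega particleFactor total
  simp only [Finset.prod_div_distrib, Finset.prod_mul_distrib, Finset.prod_pow_eq_pow_sum,
    Finset.sum_add_distrib]

/-- At the height of particle i exactly i particles of its own level lie below. The excess there is
thus 0 when it touches its inferior neighbour and 1 when it touches the superior one, which decides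
between the two squared weights in `siteFactor`. -/
theorem siteFactor_eq {a b : ℝ} (ha : 0 < a) (hb : 0 < b) {x : Positions} {l : ℕ}
    (hx : StrictMono (x l)) (hy : StrictMono (x (l + 1))) {i : Fin l}
    (h1 : x (l + 1) i.castSucc ≤ x l i) (h2 : x l i ≤ x (l + 1) i.succ) :
    siteFactor a b l (Finset.univ.image (x l)) (Finset.univ.image (x (l + 1))) (x l i) =
      (a ^ 2 + b ^ 2) / (a * b) * particleFactor a b x l i := by
  have hlt : x (l + 1) i.castSucc < x (l + 1) i.succ := hy (Fin.castSucc_lt_succ)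
  have hA : x l i ∈ Finset.univ.image (x l) := Finset.mem_image_of_mem _ (Finset.mem_univ i)
  have cA : ((Finset.univ.image (x l)).filter (· < x l i)).card = i := by
    rw [Finset.filter_image, Finset.card_image_of_injective _ hx.injective]
    simp only [hx.lt_iff_lt]
    rw [Finset.filter_gt_eq_Iio, Fin.card_Iio]
  have cB1 := lt_card_filter_iff hy i.castSucc (x l i)
  have cB2 := lt_card_filter_iff hy i.succ (x l i)
  rw [Fin.val_castSucc] at cB1
  rw [Fin.val_succ] at cB2
  have hab : 0 < a ^ 2 + b ^ 2 := by positivity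
  rw [siteFactor, if_pos hA, particleFactor, adjacency, infOdd, infEven, supOdd, supEven]
  rcases h1.eq_or_lt with e1 | e1
  · have hB : x l i ∈ Finset.univ.image (x (l + 1)) :=
      Finset.mem_image.2 ⟨i.castSucc, Finset.mem_univ _, e1⟩
    have hne : x l i ≠ x (l + 1) i.succ := by omega
    have hex : excess (Finset.univ.image (x l)) (Finset.univ.image (x (l + 1))) (x l i) = 0 := by
      unfold excess
      have : ¬ ((i : ℕ) < ((Finset.univ.image (x (l + 1))).filter (· < x l i)).card) := by
        rw [cB1]; omega
      have h3 : (i : ℕ) ≤ ((Finset.univ.image (x (l + 1))).filter (· < x l i)).card := by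
        rcases Nat.eq_zero_or_pos (i : ℕ) with h0 | h0
        · omega
        · have h4 := lt_card_filter_iff hy ⟨(i : ℕ) - 1, by omega⟩ (x l i)
          have h5 : x (l + 1) ⟨(i : ℕ) - 1, by omega⟩ < x (l + 1) i.castSucc := by
            apply hy
            rw [Fin.lt_def]
            simp only [Fin.val_castSucc]
            omega
          have := h4.2 (by omega)
          simp only at this
          omega
      omega
    rw [if_pos hB, if_pos hex]
    by_cases hev : Even (l + x l i)
    · have hodd : ¬ Odd (l + x l i) := Nat.not_odd_iff_even.2 hev
      simp only [chess, Nat.even_add_one, eq_true hev, eq_false hodd, eq_true e1.symm, eq_false hne]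
      norm_num
      field_simp
    · have hodd : Odd (l + x l i) := Nat.not_even_iff_odd.1 hev
      simp only [chess, Nat.even_add_one, eq_false hev, eq_true hodd, eq_true e1.symm, eq_false hne]
      norm_num
      field_simp
  · have hne1 : x l i ≠ x (l + 1) i.castSucc := by omega
    rcases h2.eq_or_lt with e2 | e2
    · have hB : x l i ∈ Finset.univ.image (x (l + 1)) :=
        Finset.mem_image.2 ⟨i.succ, Finset.mem_univ _, e2.symm⟩
      have hex : excess (Finset.univ.image (x l)) (Finset.univ.image (x (l + 1))) (x l i) ≠ 0 := by
        unfold excess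
        have := cB1.2 e1
        omega
      rw [if_pos hB, if_neg hex]
      by_cases hev : Even (l + x l i)
      · have hodd : ¬ Odd (l + x l i) := Nat.not_odd_iff_even.2 hev
        simp only [chess, eq_true hev, eq_false hodd, eq_false hne1, eq_true e2]
        norm_num
        field_simp
      · have hodd : Odd (l + x l i) := Nat.not_even_iff_odd.1 hev
        simp only [chess, eq_false hev, eq_true hodd, eq_false hne1, eq_true e2]
        norm_num
        field_simp
    · have hne2 : x l i ≠ x (l + 1) i.succ := by omega
      have hB : x l i ∉ Finset.univ.image (x (l + 1)) := by
        intro hB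
        obtain ⟨k, -, hk⟩ := Finset.mem_image.1 hB
        have k1 := hy.lt_iff_lt.1 (show x (l + 1) i.castSucc < x (l + 1) k by omega)
        have k2 := hy.lt_iff_lt.1 (show x (l + 1) k < x (l + 1) i.succ by omega)
        rw [Fin.lt_def] at k1 k2
        simp at k1 k2
        omega
      rw [if_neg hB]
      simp [hne1, hne2]

open Classical in
/-- The total weight of the configurations with the particles `x` on the levels `m` to `n + 1`. -/
noncomputable def producedWeight (n : ℕ) (a b : ℝ) (m : ℕ) (x : Positions) : ℝ :=
  ∑ c : Config n with Produces c m x, weight a b c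

theorem rho_eq_div (n : ℕ) (a b : ℝ) (m : ℕ) (x : Positions) :
    rho n a b m x = producedWeight n a b m x / Z n a b := by
  classical
  unfold rho producedWeight prob
  rw [Finset.sum_div]

/-- Levels 1 to n + 1 fix all the particles, so the sum is a product of column sums; a single column
that fails to interlace makes it vanish. -/
theorem producedWeight_one {a b : ℝ} (ha : 0 < a) (hb : 0 < b) (n : ℕ) (x : Positions) :
    producedWeight n a b 1 x =
      (a ^ 2 + b ^ 2) ^ (n * (n + 1) / 2) * Omega a b 1 n x * chi n 1 x := by
  classical
  by_cases hm : ∀ l ∈ Finset.Icc 1 (n + 1), StrictMono (x l) ∧ ∀ i, x l i ≤ n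
  swap
  · have hchi : chi n 1 x = 0 := if_neg fun h => hm h.1
    rw [hchi, mul_zero]
    refine Finset.sum_eq_zero fun c hc => absurd (fun l hl => ?_) hm
    have := (Finset.mem_filter.1 hc).2 l hl
    refine ⟨this.1, fun i => particles_subset c l _ ?_⟩
    rw [← this.2]
    exact Set.mem_range_self i
  set A : ℕ → Finset ℕ := fun l => Finset.univ.image (x l) with hAdef
  have hmono : ∀ l, l ≤ n + 1 → StrictMono (x l) := by
    intro l hl
    rcases Nat.eq_zero_or_pos l with rfl | h0
    · exact fun i => i.elim0
    · exact (hm l (Finset.mem_Icc.2 ⟨h0, hl⟩)).1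
  have hle : ∀ l, l ≤ n + 1 → ∀ i, x l i ≤ n := by
    intro l hl i
    exact (hm l (Finset.mem_Icc.2 ⟨by have := i.2; omega, hl⟩)).2 i
  have hA : ∀ l, l ≤ n + 1 → A l ⊆ Finset.range (n + 1) := by
    intro l hl h hh
    obtain ⟨i, -, rfl⟩ := Finset.mem_image.1 hh
    exact Finset.mem_range.2 (Nat.lt_succ_of_le (hle l hl i))
  have hcard : ∀ l, l ≤ n + 1 → (A l).card = l := by
    intro l hl
    rw [hAdef]
    simp only
    rw [Finset.card_image_of_injective _ (hmono l hl).injective]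
    simp
  have h0 : A 0 = ∅ := by simp [hAdef]
  have hfull : A (n + 1) = Finset.range (n + 1) :=
    Finset.eq_of_subset_of_card_le (hA _ le_rfl) (by rw [hcard _ le_rfl]; simp)
  unfold producedWeight
  rw [sum_weight_eq_prod a b h0 hfull hA]
  swap
  · intro c
    rw [Finset.mem_filter, and_iff_right (Finset.mem_univ c)]
    simp only [Produces, hAdef, Finset.coe_image, Finset.coe_univ, Set.image_univ]
    constructor
    · intro h l hl
      rcases Nat.eq_zero_or_pos l with rfl | hl0
      · rw [particles_zero]; simp
      · exact (h l (Finset.mem_Icc.2 ⟨hl0, hl⟩)).2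
    · intro h l hl
      exact ⟨(hm l hl).1, h l (Finset.mem_Icc.1 hl).2⟩
  have hex : ∀ l : Fin (n + 1), excess (A l) (A (l + 1)) (n + 1) = 1 := by
    intro l
    have hf : ∀ k ≤ n + 1, (A k).filter (· < n + 1) = A k := fun k hk =>
      Finset.filter_eq_self.2 fun h hh => Finset.mem_range.1 (hA k hk hh)
    rw [excess, hf _ (by omega), hf _ (by omega), hcard _ (by omega), hcard _ (by omega)]
    push_cast
    ring
  rw [Finset.prod_congr rfl fun (l : Fin (n + 1)) _ =>
    sum_covers ha hb l n (A l) (A (l + 1)) (hA l (by omega)) (hex l)]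
  have hiff : ∀ l, l ≤ n → ((∀ i, x (l + 1) i.castSucc ≤ x l i ∧ x l i ≤ x (l + 1) i.succ) ↔
      ∀ j ≤ n, excess (A l) (A (l + 1)) j = 0 ∨ excess (A l) (A (l + 1)) j = 1) := fun l hl =>
    interlaced_iff_excess (hmono l (by omega)) (hmono (l + 1) (by omega)) (hle l (by omega))
      (hle (l + 1) (by omega))
  by_cases hint : ∀ l ∈ Finset.Icc 1 n, ∀ i : Fin l,
      x (l + 1) i.castSucc ≤ x l i ∧ x l i ≤ x (l + 1) i.succ
  · have hint' : ∀ l, l ≤ n → ∀ i : Fin l,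
        x (l + 1) i.castSucc ≤ x l i ∧ x l i ≤ x (l + 1) i.succ := fun l hl i =>
      hint l (Finset.mem_Icc.2 ⟨by have := i.2; omega, hl⟩) i
    have hchi : chi n 1 x = 1 := if_pos ⟨hm, hint⟩
    have hstep : ∀ l : Fin (n + 1),
        (if ∀ j ≤ n, excess (A l) (A (l + 1)) j = 0 ∨ excess (A l) (A (l + 1)) j = 1 then
          (∏ j ∈ Finset.range n, chess a b (l + j)) * ∏ j ∈ A l, siteFactor a b l (A l) (A (l + 1)) j
          else 0) = (∏ j ∈ Finset.range n, chess a b (l + j)) *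
            (((a ^ 2 + b ^ 2) / (a * b)) ^ (l : ℕ) * ∏ i : Fin l, particleFactor a b x l i) := by
      intro l
      have hl : (l : ℕ) ≤ n := by omega
      rw [if_pos ((hiff l hl).1 (hint' l hl))]
      congr 1
      have hinj := (hmono l (by omega)).injective
      rw [hAdef]
      simp only
      rw [Finset.prod_image (fun i _ j _ h => hinj h)]
      rw [Finset.prod_congr rfl fun i _ => siteFactor_eq ha hb (hmono l (by omega))
        (hmono (l + 1) (by omega)) (hint' l hl i).1 (hint' l hl i).2]
      rw [Finset.prod_mul_distrib, Finset.prod_const, Finset.card_univ, Fintype.card_fin]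
    rw [Finset.prod_congr rfl fun l _ => hstep l,
      Fin.prod_univ_eq_prod_range (fun l => (∏ j ∈ Finset.range n, chess a b (l + j)) *
            (((a ^ 2 + b ^ 2) / (a * b)) ^ (l : ℕ) * ∏ i : Fin l, particleFactor a b x l i)),
      Finset.prod_mul_distrib, Finset.prod_mul_distrib, prod_chess, Finset.prod_pow_eq_pow_sum,
      hchi, mul_one, Omega_eq_prod, Finset.range_eq_Ico,
      Finset.prod_eq_prod_Ico_succ_bot (Nat.succ_pos n)]
    rw [← Finset.range_eq_Ico, Finset.sum_range_id, Nat.add_sub_cancel, mul_comm (n + 1) n,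
      div_pow]
    -- The hole weights of all columns multiply to (ab)^{n(n+1)/2}, which cancels the factors 1/(ab)
    -- carried by the 0 + 1 + ⋯ + n particles.
    have hab : (a * b) ^ (n * (n + 1) / 2) ≠ 0 := by positivity
    have hI : Finset.Ico (0 + 1) (n + 1) = Finset.Icc 1 n := by
      ext k; simp only [Finset.mem_Ico, Finset.mem_Icc]; omega
    rw [hI]
    field_simp
    simp
  · have hchi : chi n 1 x = 0 := if_neg fun h => hint h.2
    rw [hchi, mul_zero]
    push Not at hint
    obtain ⟨l, hl, i, hi⟩ := hint
    rw [Finset.mem_Icc] at hl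
    refine Finset.prod_eq_zero (Finset.mem_univ (⟨l, by omega⟩ : Fin (n + 1))) (if_neg fun h => ?_)
    have := (hiff l hl.2).2 h i
    exact absurd this.2 (not_le.2 (hi this.1))

theorem weight_pos {a b : ℝ} (ha : 0 < a) (hb : 0 < b) {n : ℕ} (c : Config n) :
    0 < weight a b c := by
  refine Finset.prod_pos fun i _ => Finset.prod_pos fun j _ => pow_pos ?_ _
  unfold faceWeight
  split_ifs <;> assumption

/-- No explicit matching is needed: the formula for m = 1 is positive at the interlacing family of
bottom-packed levels, so some configuration produces it. -/
theorem Z_pos {a b : ℝ} (ha : 0 < a) (hb : 0 < b) (n : ℕ) : 0 < Z n a b := by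
  classical
  have hex : ∃ c : Config n, Produces c 1 fun l i => (i : ℕ) := by
    by_contra hne
    push Not at hne
    have h := producedWeight_one ha hb n fun l i => (i : ℕ)
    rw [producedWeight, Finset.sum_eq_zero fun c hc => absurd (Finset.mem_filter.1 hc).2 (hne c)] at h
    have hchi : chi n 1 (fun l i => (i : ℕ)) = 1 := by
      refine if_pos ⟨fun l hl => ⟨fun i j hij => hij, fun i => ?_⟩, fun l _ i => ?_⟩
      · have := (Finset.mem_Icc.1 hl).2
        have := i.2
        simp only
        omega
      · simp
    rw [hchi, Omega] at h
    have : 0 < a ^ 2 + b ^ 2 := by positivity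
    refine absurd h (ne_of_lt ?_)
    positivity
  obtain ⟨c, -⟩ := hex
  exact Finset.sum_pos (fun c _ => weight_pos ha hb c) ⟨c, Finset.mem_univ c⟩

/-! ### Induction on the lowest prescribed level -/

/-- Summing over the particles of one more level. -/
theorem producedWeight_succ (n : ℕ) (a b : ℝ) {m : ℕ} (hm : m ≤ n) (x : Positions) :
    producedWeight n a b (m + 1) x =
      ∑ y ∈ Fintype.piFinset fun _ : Fin m => Finset.range (n + 1),
        producedWeight n a b m (Function.update x m y) := by
  classical
  unfold producedWeight
  -- Level m always carries exactly m particles, so their increasing enumeration is defined for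
  -- every configuration, and the sum splits along its fibres.
  let e : Config n → Fin m → ℕ := fun c =>
    (level c m).orderEmbOfFin (card_level c m (by omega))
  rw [← Finset.sum_fiberwise_of_maps_to (g := e)
    (t := Fintype.piFinset fun _ : Fin m => Finset.range (n + 1))]
  swap
  · intro c _
    rw [Fintype.mem_piFinset]
    exact fun i => level_subset c m (Finset.orderEmbOfFin_mem _ _ i)
  refine Finset.sum_congr rfl fun y _ => Finset.sum_congr ?_ fun _ _ => rfl
  rw [Finset.filter_filter]
  refine Finset.filter_congr fun c _ => ?_
  unfold Produces
  constructor
  · rintro ⟨h1, h2⟩ l hl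
    rcases eq_or_ne l m with rfl | hne
    · rw [Function.update_self, ← h2]
      refine ⟨OrderEmbedding.strictMono _, ?_⟩
      simp only [e]
      rw [Finset.range_orderEmbOfFin]
      ext h
      exact mem_level c l h
    · rw [Function.update_of_ne hne]
      rw [Finset.mem_Icc] at hl
      exact h1 l (Finset.mem_Icc.2 ⟨by omega, hl.2⟩)
  · intro h
    constructor
    · intro l hl
      rw [Finset.mem_Icc] at hl
      have := h l (Finset.mem_Icc.2 ⟨by omega, hl.2⟩)
      rwa [Function.update_of_ne (by omega)] at this
    · have := h m (Finset.mem_Icc.2 ⟨le_rfl, by omega⟩)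
      rw [Function.update_self] at this
      refine (Finset.orderEmbOfFin_unique _ (fun i => ?_) this.1).symm
      rw [mem_level, ← this.2]
      exact Set.mem_range_self i

/-- Because 1/2 + v = b²/(a² + b²) and 1/2 - v = a²/(a² + b²); strictness of the neighbours prevents
a particle from touching both. -/
theorem particleFactor_eq_siteWeight {a b : ℝ} (ha : 0 < a) (hb : 0 < b) {x : Positions} {l : ℕ}
    {i : Fin l} (h : x (l + 1) i.castSucc < x (l + 1) i.succ) :
    particleFactor a b x l i =
      siteWeight (vParam a b) l (x (l + 1) i.castSucc) (x (l + 1) i.succ) (x l i) := by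
  have hab : 0 < a ^ 2 + b ^ 2 := by positivity
  rw [particleFactor, adjacency, infOdd, infEven, supOdd, supEven, siteWeight, vParam]
  by_cases e1 : x l i = x (l + 1) i.castSucc
  · have e2 : x l i ≠ x (l + 1) i.succ := by omega
    rw [← e1]
    by_cases hev : Even (l + x l i)
    · have hodd : ¬ Odd (l + x l i) := Nat.not_odd_iff_even.2 hev
      simp only [eq_true hev, eq_false hodd, eq_false e2, parity, hev.neg_one_pow]
      norm_num
      field_simp
      ring
    · have hodd : Odd (l + x l i) := Nat.not_even_iff_odd.1 hev
      simp only [eq_false hev, eq_true hodd, eq_false e2, parity, hodd.neg_one_pow]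
      norm_num
      field_simp
      ring
  · by_cases e2 : x l i = x (l + 1) i.succ
    · rw [← e2]
      by_cases hev : Even (l + x l i)
      · have hodd : ¬ Odd (l + x l i) := Nat.not_odd_iff_even.2 hev
        simp only [eq_true hev, eq_false hodd, eq_false e1, parity, hev.neg_one_pow]
        norm_num
        field_simp
        ring
      · have hodd : Odd (l + x l i) := Nat.not_even_iff_odd.1 hev
        simp only [eq_false hev, eq_true hodd, eq_false e1, parity, hodd.neg_one_pow]
        norm_num
        field_simp
        ring
    · simp [e1, e2]

theorem Omega_update {a b : ℝ} (ha : 0 < a) (hb : 0 < b) {m n : ℕ} (hm : m ≤ n) (x : Positions)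
    (hx : StrictMono (x (m + 1))) (y : Fin m → ℕ) :
    Omega a b m n (Function.update x m y) =
      (∏ i, siteWeight (vParam a b) m (x (m + 1) i.castSucc) (x (m + 1) i.succ) (y i)) *
        Omega a b (m + 1) n x := by
  have hne : ∀ l, m < l → Function.update x m y l = x l := fun l hl =>
    Function.update_of_ne (by omega) _ _
  rw [Omega_eq_prod, Omega_eq_prod, ← Finset.insert_Icc_add_one_left_eq_Icc hm,
    Finset.prod_insert (by simp)]
  congr 1
  · refine Finset.prod_congr rfl fun i _ => ?_
    rw [particleFactor_eq_siteWeight ha hb]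
    · rw [Function.update_self, hne _ (Nat.lt_succ_self m)]
    · rw [hne _ (Nat.lt_succ_self m)]
      exact hx Fin.castSucc_lt_succ
  · refine Finset.prod_congr rfl fun l hl => Finset.prod_congr rfl fun i _ => ?_
    rw [Finset.mem_Icc] at hl
    simp only [particleFactor, adjacency, infOdd, infEven, supOdd, supEven, hne l (by omega),
      hne (l + 1) (by omega)]

theorem interlaced_update {m n : ℕ} (hm : m ≤ n) (x : Positions) (y : Fin m → ℕ) :
    Interlaced n m (Function.update x m y) ↔ Interlaced n (m + 1) x ∧
      (StrictMono y ∧ ∀ i, y i ≤ n) ∧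
        ∀ i, x (m + 1) i.castSucc ≤ y i ∧ y i ≤ x (m + 1) i.succ := by
  have hne : ∀ l, m < l → Function.update x m y l = x l := fun l hl =>
    Function.update_of_ne (by omega) _ _
  unfold Interlaced
  rw [← Finset.insert_Icc_add_one_left_eq_Icc hm,
    ← Finset.insert_Icc_add_one_left_eq_Icc (show m ≤ n + 1 by omega)]
  simp only [Finset.forall_mem_insert, Function.update_self, hne _ (Nat.lt_succ_self m)]
  have h1 : (∀ l ∈ Finset.Icc (m + 1) (n + 1), StrictMono (Function.update x m y l) ∧
      ∀ i, Function.update x m y l i ≤ n) ↔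
      ∀ l ∈ Finset.Icc (m + 1) (n + 1), StrictMono (x l) ∧ ∀ i, x l i ≤ n := by
    refine forall₂_congr fun l hl => ?_
    rw [Finset.mem_Icc] at hl
    rw [hne l (by omega)]
  have h2 : (∀ l ∈ Finset.Icc (m + 1) n, ∀ i : Fin l,
      Function.update x m y (l + 1) i.castSucc ≤ Function.update x m y l i ∧
        Function.update x m y l i ≤ Function.update x m y (l + 1) i.succ) ↔
      ∀ l ∈ Finset.Icc (m + 1) n, ∀ i : Fin l,
        x (l + 1) i.castSucc ≤ x l i ∧ x l i ≤ x (l + 1) i.succ := by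
    refine forall₂_congr fun l hl => ?_
    rw [Finset.mem_Icc] at hl
    rw [hne l (by omega), hne (l + 1) (by omega)]
  rw [h1, h2]
  tauto

theorem modVandermonde_eq_zero {m : ℕ} (v : ℝ) {y : Fin m → ℕ} (hy : ¬ Function.Injective y) :
    modVandermonde v m y = 0 := by
  unfold Function.Injective at hy
  push Not at hy
  obtain ⟨i, j, hij, hne⟩ := hy
  rw [modVandermonde_eq]
  refine Matrix.det_zero_of_row_eq hne ?_
  funext k
  simp [hij]

theorem producedWeight_eq {a b : ℝ} (ha : 0 < a) (hb : 0 < b) (n m : ℕ) (h1 : 1 ≤ m)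
    (hm : m ≤ n + 1) (x : Positions) :
    producedWeight n a b m x = (a ^ 2 + b ^ 2) ^ (n * (n + 1) / 2) *
      modVandermonde (vParam a b) m (x m) * Omega a b m n x * chi n m x := by
  classical
  induction m, h1 using Nat.le_induction generalizing x with
  | base =>
    rw [producedWeight_one ha hb]
    simp [modVandermonde]
  | succ m h1 ih =>
    rw [producedWeight_succ n a b (by omega)]
    simp only [ih (by omega), Function.update_self]
    by_cases hI : Interlaced n (m + 1) x
    · have hz := (hI.1 (m + 1) (Finset.mem_Icc.2 ⟨le_rfl, hm⟩))
      have hchi : chi n (m + 1) x = 1 := if_pos hI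
      simp only [Omega_update ha hb (show m ≤ n by omega) x hz.1]
      rw [hchi, modVandermonde_succ _ _ _ hz.1.monotone, Finset.mul_sum, Finset.sum_mul,
        Finset.sum_mul]
      have hsub : (Fintype.piFinset fun i : Fin m =>
          Finset.Icc (x (m + 1) i.castSucc) (x (m + 1) i.succ)) ⊆
          Fintype.piFinset fun _ : Fin m => Finset.range (n + 1) := by
        refine Fintype.piFinset_subset _ _ fun i k hk => ?_
        rw [Finset.mem_range]
        exact Nat.lt_succ_of_le ((Finset.mem_Icc.1 hk).2.trans (hz.2 _))
      rw [← Finset.sum_subset hsub]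
      · refine Finset.sum_congr rfl fun y hy => ?_
        have hy' : ∀ i, x (m + 1) i.castSucc ≤ y i ∧ y i ≤ x (m + 1) i.succ := fun i =>
          Finset.mem_Icc.1 (Fintype.mem_piFinset.1 hy i)
        -- Interlacing positions are weakly increasing, so they fail to be admissible only when two
        -- coincide; then the determinant has two equal rows, and the missing indicator does no
        -- harm.
        by_cases hinj : Function.Injective y
        · have hmono : Monotone y := by
            intro i j hij
            rcases hij.eq_or_lt with rfl | hlt
            · exact le_rfl
            · refine (hy' i).2.trans (le_trans (hz.1.monotone ?_) (hy' j).1)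
              rw [Fin.le_def, Fin.val_succ, Fin.val_castSucc]
              exact hlt
          have : chi n m (Function.update x m y) = 1 :=
            if_pos ((interlaced_update (by omega) x y).2 ⟨hI,
              ⟨hmono.strictMono_of_injective hinj, fun i => (hy' i).2.trans (hz.2 _)⟩, hy'⟩)
          rw [this]
          ring
        · rw [modVandermonde_eq_zero _ hinj]
          ring
      · intro y _ hy
        have : chi n m (Function.update x m y) = 0 := by
          refine if_neg fun h => hy ?_
          rw [Fintype.mem_piFinset]
          exact fun i => Finset.mem_Icc.2 (((interlaced_update (by omega) x y).1 h).2.2 i)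
        rw [this, mul_zero]
    · have hchi : chi n (m + 1) x = 0 := if_neg hI
      rw [hchi, mul_zero]
      refine Finset.sum_eq_zero fun y _ => ?_
      have : chi n m (Function.update x m y) = 0 :=
        if_neg fun h => hI ((interlaced_update (by omega) x y).1 h).1
      rw [this, mul_zero]

end AztecDiamond

open AztecDiamond in
theorem mainTheorem4 (a b : ℝ) (ha : 0 < a) (hb : 0 < b) :
    -- the joint distribution of the particles on the levels m to n + 1
    (∀ n m : ℕ, 1 ≤ m → m ≤ n + 1 →
      0 < Z n a b ∧
      ∀ x : Positions,
        rho n a b m x =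
          (a ^ 2 + b ^ 2) ^ (n * (n + 1) / 2) / Z n a b * modVandermonde (vParam a b) m (x m) *
            Omega a b m n x * chi n m x) ∧
    -- the parameter v
    vParam a b ∈ Set.Icc (-(1 / 2) : ℝ) (1 / 2) ∧
    -- the recurrence of the coefficients
    alphaCoeff (vParam a b) 0 = vParam a b ∧
    (∀ k : ℕ, 1 ≤ k →
      alphaCoeff (vParam a b) k = ∑ l ∈ Finset.Icc 2 k,
        (vParam a b * alphaCoeff (vParam a b) (l - 2) * alphaCoeff (vParam a b) (k - l) -
          2 ^ l * (bernoulli l : ℝ) / (l.factorial : ℝ) * alphaCoeff (vParam a b) (k - l))) ∧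
    -- their generating function near z = 0; for v = 0 its value is the limit 0
    (vParam a b ≠ 0 → ∀ᶠ z : ℂ in 𝓝[≠] 0,
      HasSum (fun k : ℕ => (alphaCoeff (vParam a b) k : ℂ) * z ^ k)
        ((1 - Complex.sqrt (1 - 4 * (vParam a b : ℂ) ^ 2 * Complex.tanh z ^ 2)) /
          (2 * (vParam a b : ℂ) * z * Complex.tanh z))) ∧
    (vParam a b = 0 → ∀ k : ℕ, alphaCoeff (vParam a b) k = 0) := by
  refine ⟨fun n m h1 hm => ⟨Z_pos ha hb n, fun x => ?_⟩, vParam_mem a b ha,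
    (alphaRec_alphaCoeff _).1, (alphaRec_alphaCoeff _).2, hasSum_alphaCoeff, fun h k => ?_⟩
  · rw [rho_eq_div, producedWeight_eq ha hb n m h1 hm]
    ring
  · rw [h, alphaCoeff_zero_param]
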